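/- Let $(\boldsymbol A,\boldsymbol B,X,Y)$ be a bipartite Bell scenario: Alice has inputs $x\in[X]$ with outcomes $a\in[A_x]$, Bob has inputs $y\in[Y]$ with outcomes $b\in[B_y]$, where $X,Y\ge 1$. A correlation is a vector $p=(p(a,b|x,y))$ such that $p(\cdot,\cdot|x,y)$ is a probability distribution for all $x,y$. **Bell sets.** A correlation is *non-signalling* if $\sum_b p(a,b|x,y)$ does not depend on $y$ and $\sum_a p(a,b|x,y)$ does not depend on $x$. It is *local* if $p(a,b|x,y)=\int_L l^{\rm A}(a|x,\lambda)\,l^{\rm B}(b|y,\lambda)\,d\mu(\lambda)$ for a probability space $(L,\Sigma,\mu)$ and measurable non-negative functions with $\sum_a l^{\rm A}(a|x,\lambda)=\sum_b l^{\rm B}(b|y,\lambda)=1$ for all $x,y,\lambda$. It is in $\mathcal C_{qs}$ (*quantum spatial*) if $p(a,b|x,y)=\mathrm{Tr}\big((M^x_a\otimes N^y_b)\rho\big)$ for POVMs $\{M^x_a\}_a$ and $\{N^y_b\}_b$ on separable, possibly infinite-dimensional, Hilbert spaces $\mathcal H_{\rm A}$ and $\mathcal H_{\rm B}$ and a density operator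 $\rho$ on $\mathcal H_{\rm A}\otimes\mathcal H_{\rm B}$. For $p$ in any of these sets, Alice's marginal $p_{\rm A}(a|x)=\sum_b p(a,b|x,y)$ is independent of $y$. **Contextuality sets.** Let $r=(r(a|x))_{x\in[X],\,a\in[A_x]}$ be such that $r(\cdot|x)$ is a probability distribution on $[A_x]$ for every $x\in[X]$. The contextuality scenario $\mathrm{NS}(r)$ has one preparation $P_{a|x}$ for each pair with $r(a|x)>0$, Bob's measurements $y\in[Y]$ with outcomes $b\in[B_y]$, and the preparation equivalences $$\sum_a r(a|1)P_{a|1}\simeq\sum_a r(a|2)P_{a|2}\simeq\cdots\simeq\sum_a r(a|X)P_{a|X}$$ (sums over $a$ with $r(a|x)>0$), and no measurement equivalences. A behaviour in $\mathrm{NS}(r)$ is a vector $q=(q(b|[a|x],y))$ such that $q(\cdot|[a|x],y)$ is a probability distribution for every preparation $P_{a|x}$ and every $y$. It is * *contextual* if, for all $b,y$, the number $\sum_a r(a|x)\,q(b|[a|x],y)$ does not depend on $x$; * *non-contextual* if $q(b|[a|x],y)=\int_L \xi_y(b|\lambda)\,d\mu_{a|x}(\lambda)$ for probability measures $\mu_{a|x}$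 on a measurable space $L$ such that $\sum_a r(a|x)\mu_{a|x}$ does not depend on $x$, and measurable $\xi_y(b|\cdot)\ge 0$ with $\sum_b\xi_y(b|\lambda)=1$ for all $y,\lambda$; * *quantum* if $q(b|[a|x],y)=\mathrm{Tr}(N^y_b\rho_{a|x})$ for POVMs $\{N^y_b\}_b$ and density operators $\rho_{a|x}$ on a separable, possibly infinite-dimensional, Hilbert space such that $\sum_a r(a|x)\rho_{a|x}$ does not depend on $x$. **The map.** Let $\Lambda$ send $p$ to the pair $(p_{\rm A},q)$, where $q$ is the vector in the scenario $\mathrm{NS}(p_{\rm A})$ with $$q(b|[a|x],y)=\frac{p(a,b|x,y)}{p_{\rm A}(a|x)}\qquad (p_{\rm A}(a|x)>0).$$ **Claim.** $\Lambda$ restricts to bijections 1. from the non-signalling correlations onto the set of pairs $(r,q)$ with $q$ a contextual behaviour in $\mathrm{NS}(r)$; 2. from the local correlations onto the set of pairs $(r,q)$ with $q$ a non-contextual behaviour in $\mathrm{NS}(r)$; 3. from $\mathcal C_{qs}$ onto the set of pairs $(r,q)$ with $q$ a quantum behaviour in $\mathrm{NS}(r)$; where $r$ ranges over all families of probability distributions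 as above. In all three cases the inverse is the map $\Lambda^{-1}:(r,q)\mapsto p$ given by $$p(a,b|x,y)=\begin{cases} r(a|x)\,q(b|[a|x],y) & \text{if } r(a|x)>0,\\ 0 & \text{otherwise.}\end{cases}$$ -/

import Mathlib

open MeasureTheory
open scoped TensorProduct InnerProductSpace

namespace BellContextuality

noncomputable section

/-! ### Operators on Hilbert spaces -/

section Operators

variable {H : Type} [NormedAddCommGroup H] [InnerProductSpace ℂ H]

/-- The bounded operator `T` has a trace, equal to `t`: the series `∑ᵢ ⟨eᵢ, T eᵢ⟩` converges
unconditionally to the same value `t` for every orthonormal (Hilbert) basis `e`. -/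
def HasTrace (T : H →L[ℂ] H) (t : ℂ) : Prop :=
  ∀ (ι : Type) (e : HilbertBasis ι ℂ H), HasSum (fun i => ⟪e i, T (e i)⟫_ℂ) t

/-- A density operator: positive semidefinite with trace one. -/
structure IsDensityOperator (ρ : H →L[ℂ] H) : Prop where
  positive : ρ.IsPositive
  trace_one : HasTrace ρ 1

/-- A POVM with outcomes `1, …, n`: positive semidefinite operators that sum to the identity. -/
structure IsPOVM {n : ℕ} (M : Fin n → H →L[ℂ] H) : Prop where
  positive : ∀ a, (M a).IsPositive
  sum_eq_one : ∑ a, M a = ContinuousLinearMap.id ℂ H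

variable (H) in
/-- The Hilbert space tensor product: the completion of the algebraic tensor product. -/
abbrev HilbertTensor (K : Type) [NormedAddCommGroup K] [InnerProductSpace ℂ K] : Type :=
  UniformSpace.Completion (H ⊗[ℂ] K)

/-- The bounded operator `M ⊗ N` on the Hilbert space tensor product. -/
def tensorOp {K : Type} [NormedAddCommGroup K] [InnerProductSpace ℂ K]
    (M : H →L[ℂ] H) (N : K →L[ℂ] K) : HilbertTensor H K →L[ℂ] HilbertTensor H K :=
  (TensorProduct.mapL M N).completion

end Operators

/-- A family of response functions `ξ(b | ·)` with outcomes `b = 1, …, n` on a measurable space: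
measurable, non-negative, and summing to one at every point. -/
structure IsResponse {L : Type} [MeasurableSpace L] {n : ℕ} (ξ : Fin n → L → ℝ) : Prop where
  measurable : ∀ b, Measurable (ξ b)
  nonneg : ∀ b l, 0 ≤ ξ b l
  sum_eq_one : ∀ l, ∑ b, ξ b l = 1

/-! ### Bell scenarios -/

/-- A two-party Bell scenario `(A, B, X, Y)`: Alice has `X` inputs and `A x` outcomes for input
`x`, Bob has `Y` inputs and `B y` outcomes for input `y`; each party has at least one input. -/
structure BellScenario where
  X : ℕ
  Y : ℕ
  A : Fin X → ℕ
  B : Fin Y → ℕ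
  X_pos : 0 < X
  Y_pos : 0 < Y

namespace BellScenario

variable (S : BellScenario)

/-- Real vectors with entries `p(a,b|x,y)`, written `p x y a b`. -/
abbrev CorrVec : Type := (x : Fin S.X) → (y : Fin S.Y) → Fin (S.A x) → Fin (S.B y) → ℝ

variable {S} in
/-- `p` is a correlation: `p(·,·|x,y)` is a probability distribution for all inputs. -/
structure IsCorrelation (p : S.CorrVec) : Prop where
  nonneg : ∀ x y a b, 0 ≤ p x y a b
  sum_eq_one : ∀ x y, ∑ a, ∑ b, p x y a b = 1

/-- The set of non-signalling correlations. -/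
def nonSignalling : Set S.CorrVec :=
  {p | IsCorrelation p ∧
    (∀ x a y y', ∑ b, p x y a b = ∑ b, p x y' a b) ∧
    (∀ y b x x', ∑ a, p x y a b = ∑ a, p x' y a b)}

/-- The set `C_qs` of quantum spatial correlations: separable, possibly infinite-dimensional
Hilbert spaces for Alice and Bob, a density operator on their tensor product, local POVMs. -/
def quantumSpatial : Set S.CorrVec :=
  {p | ∃ (HA : Type) (_ : NormedAddCommGroup HA) (_ : InnerProductSpace ℂ HA)
      (_ : CompleteSpace HA) (_ : TopologicalSpace.SeparableSpace HA)
      (HB : Type) (_ : NormedAddCommGroup HB) (_ : InnerProductSpace ℂ HB)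
      (_ : CompleteSpace HB) (_ : TopologicalSpace.SeparableSpace HB)
      (M : (x : Fin S.X) → Fin (S.A x) → HA →L[ℂ] HA)
      (N : (y : Fin S.Y) → Fin (S.B y) → HB →L[ℂ] HB)
      (ρ : HilbertTensor HA HB →L[ℂ] HilbertTensor HA HB),
      (∀ x, IsPOVM (M x)) ∧ (∀ y, IsPOVM (N y)) ∧ IsDensityOperator ρ ∧
      ∀ x y a b, HasTrace (tensorOp (M x a) (N y b) ∘L ρ) (p x y a b : ℂ)}

/-- The set of local correlations (those with a local hidden variable model). -/
def localSet : Set S.CorrVec :=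
  {p | ∃ (L : Type) (_ : MeasurableSpace L) (μ : Measure L) (_ : IsProbabilityMeasure μ)
      (lA : (x : Fin S.X) → Fin (S.A x) → L → ℝ) (lB : (y : Fin S.Y) → Fin (S.B y) → L → ℝ),
      (∀ x, IsResponse (lA x)) ∧ (∀ y, IsResponse (lB y)) ∧
      ∀ x y a b, p x y a b = ∫ l, lA x a l * lB y b l ∂μ}

end BellScenario

/-! ### Contextuality scenarios -/

/-- A prepare-and-measure contextuality scenario without measurement equivalences: preparations
labelled by the finite type `P`, measurements `1, …, Y` with `B y` outcomes each, and a set of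
preparation equivalences `∑ₓ αₓ Pₓ ≃ ∑ₓ βₓ Pₓ`, each given by a pair `(α, β)` of probability
distributions on the preparations. -/
structure ContextualityScenario (P : Type) [Fintype P] (Y : ℕ) (B : Fin Y → ℕ) where
  prepEquiv : Set ((P → ℝ) × (P → ℝ))
  prob : ∀ e ∈ prepEquiv, e.1 ∈ stdSimplex ℝ P ∧ e.2 ∈ stdSimplex ℝ P

namespace ContextualityScenario

variable {P : Type} [Fintype P] {Y : ℕ} {B : Fin Y → ℕ} (C : ContextualityScenario P Y B)

/-- The set of contextual behaviours: vectors `q(b|x,y)`, written `q x y b`, of probabilities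
that respect all the preparation equivalences. -/
def contextual : Set (P → (y : Fin Y) → Fin (B y) → ℝ) :=
  {q | (∀ x y b, 0 ≤ q x y b) ∧ (∀ x y, ∑ b, q x y b = 1) ∧
    ∀ e ∈ C.prepEquiv, ∀ y b, ∑ x, e.1 x * q x y b = ∑ x, e.2 x * q x y b}

/-- The set `Q` of quantum behaviours: density operators on a separable, possibly
infinite-dimensional Hilbert space that satisfy the preparation equivalences, and POVMs. -/
def quantum : Set (P → (y : Fin Y) → Fin (B y) → ℝ) :=
  {q | ∃ (H : Type) (_ : NormedAddCommGroup H) (_ : InnerProductSpace ℂ H)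
      (_ : CompleteSpace H) (_ : TopologicalSpace.SeparableSpace H)
      (N : (y : Fin Y) → Fin (B y) → H →L[ℂ] H) (ρ : P → H →L[ℂ] H),
      (∀ y, IsPOVM (N y)) ∧ (∀ x, IsDensityOperator (ρ x)) ∧
      (∀ e ∈ C.prepEquiv, ∑ x, (e.1 x : ℂ) • ρ x = ∑ x, (e.2 x : ℂ) • ρ x) ∧
      ∀ x y b, HasTrace (N y b ∘L ρ x) (q x y b : ℂ)}

/-- The set of non-contextual behaviours: probability measures on a measurable (ontic) space that
satisfy the preparation equivalences, and response functions for the measurements. -/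
def nonContextual : Set (P → (y : Fin Y) → Fin (B y) → ℝ) :=
  {q | ∃ (L : Type) (_ : MeasurableSpace L) (μ : P → Measure L)
      (ξ : (y : Fin Y) → Fin (B y) → L → ℝ),
      (∀ x, IsProbabilityMeasure (μ x)) ∧ (∀ y, IsResponse (ξ y)) ∧
      (∀ e ∈ C.prepEquiv, ∀ E, MeasurableSet E →
        ∑ x, e.1 x * (μ x).real E = ∑ x, e.2 x * (μ x).real E) ∧
      ∀ x y b, q x y b = ∫ l, ξ y b l ∂(μ x)}

end ContextualityScenario

/-! ### The scenarios `NS(r)` and the map -/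

namespace BellScenario

variable (S : BellScenario)

/-- Real vectors with entries `r(a|x)`, written `r x a`. -/
abbrev MargVec : Type := (x : Fin S.X) → Fin (S.A x) → ℝ

variable {S}

/-- `r` is a family of probability distributions `r(·|x)` on Alice's outcomes. -/
def IsMarginal (r : S.MargVec) : Prop := ∀ x, r x ∈ stdSimplex ℝ (Fin (S.A x))

/-- The labels `[a|x]` of the preparations that appear in `NS(r)`: those with `r(a|x) > 0`. -/
abbrev Prep (r : S.MargVec) : Type := {s : (x : Fin S.X) × Fin (S.A x) // 0 < r s.1 s.2}

instance (r : S.MargVec) : Fintype (Prep r) := Fintype.ofFinite _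

/-- The coefficients of the mixture `∑ₐ r(a|x) P_{a|x}` as a vector on all preparations. -/
def mixture (r : S.MargVec) (x : Fin S.X) : Prep r → ℝ :=
  fun s => if s.1.1 = x then r s.1.1 s.1.2 else 0

theorem sum_mixture_mul (r : S.MargVec) (hr : ∀ x a, 0 ≤ r x a) (x : Fin S.X)
    (f : (x : Fin S.X) → Fin (S.A x) → ℝ) :
    ∑ s, mixture r x s * f s.1.1 s.1.2 = ∑ a, r x a * f x a := by
  classical
  let g : (x : Fin S.X) × Fin (S.A x) → ℝ :=
    fun s => (if s.1 = x then r s.1 s.2 else 0) * f s.1 s.2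
  have hg : ∀ s, ¬ 0 < r s.1 s.2 → g s = 0 := fun s hs => by
    have : r s.1 s.2 = 0 := le_antisymm (not_lt.mp hs) (hr _ _)
    simp [g, this]
  have h1 : ∑ s, mixture r x s * f s.1.1 s.1.2 = ∑ s, g s := by
    have h0 : ∑ s : {s : (x : Fin S.X) × Fin (S.A x) // ¬ 0 < r s.1 s.2}, g s.1 = 0 :=
      Finset.sum_eq_zero fun s _ => hg s.1 s.2
    rw [← Fintype.sum_subtype_add_sum_subtype (fun s => 0 < r s.1 s.2) g, h0, add_zero]
    refine Finset.sum_congr ?_ fun _ _ => rfl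
    ext s
    simp
  rw [h1, Fintype.sum_sigma, Finset.sum_eq_single x]
  · simp [g]
  · intro x' _ hx'
    simp [g, hx']
  · simp

theorem mixture_mem_stdSimplex {r : S.MargVec} (hr : IsMarginal r) (x : Fin S.X) :
    mixture r x ∈ stdSimplex ℝ (Prep r) := by
  refine ⟨fun s => ?_, ?_⟩
  · unfold mixture
    split_ifs
    · exact s.2.le
    · exact le_rfl
  · have h := sum_mixture_mul r (fun x a => (hr x).1 a) x (fun _ _ => 1)
    simpa using h.trans (by simpa using (hr x).2)

/-- The contextuality scenario with preparations `P_{a|x}`, where `r(a|x) > 0`, Bob's measurements,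
and the preparation equivalences `NS(r)`:
`∑ₐ r(a|1) P_{a|1} ≃ ∑ₐ r(a|2) P_{a|2} ≃ ⋯ ≃ ∑ₐ r(a|X) P_{a|X}`. -/
def nsScenario (r : S.MargVec) (hr : IsMarginal r) :
    ContextualityScenario (Prep r) S.Y S.B where
  prepEquiv := {e | ∃ x x' : Fin S.X, e = (mixture r x, mixture r x')}
  prob := by
    rintro _ ⟨x, x', rfl⟩
    exact ⟨mixture_mem_stdSimplex hr x, mixture_mem_stdSimplex hr x'⟩

variable (S) in
/-- Pairs consisting of an index `r`, which stands for the scenario with preparation equivalences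
`NS(r)`, and a vector with entries `q(b|[a|x],y)` for the preparations of that scenario. -/
abbrev IndexedVec : Type := (r : S.MargVec) × (Prep r → (y : Fin S.Y) → Fin (S.B y) → ℝ)

variable (S) in
/-- The union over the indexed family of scenarios `NS(r)` of the contextual behaviours. -/
def contextualFamily : Set S.IndexedVec :=
  {t | ∃ hr : IsMarginal t.1, t.2 ∈ (nsScenario t.1 hr).contextual}

variable (S) in
/-- The union over the indexed family of scenarios `NS(r)` of the quantum behaviours. -/
def quantumFamily : Set S.IndexedVec :=
  {t | ∃ hr : IsMarginal t.1, t.2 ∈ (nsScenario t.1 hr).quantum}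

variable (S) in
/-- The union over the indexed family of scenarios `NS(r)` of the non-contextual behaviours. -/
def nonContextualFamily : Set S.IndexedVec :=
  {t | ∃ hr : IsMarginal t.1, t.2 ∈ (nsScenario t.1 hr).nonContextual}

/-- Alice's marginal `p_A(a|x) = ∑_b p(a,b|x,y)`, computed with Bob's first input `y`; see
`marginal_eq` for the independence of `y`. -/
def marginal (p : S.CorrVec) : S.MargVec := fun x a => ∑ b, p x ⟨0, S.Y_pos⟩ a b

theorem marginal_eq {p : S.CorrVec} (hp : p ∈ S.nonSignalling) (x : Fin S.X) (a : Fin (S.A x))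
    (y : Fin S.Y) : marginal p x a = ∑ b, p x y a b :=
  hp.2.1 x a _ y

variable (S) in
/-- The map `Λ` from Bell correlations to behaviours: `q(b|[a|x],y) = p(a,b|x,y) / p_A(a|x)` in
the scenario `NS(p_A)`. -/
def toContextuality (p : S.CorrVec) : S.IndexedVec :=
  ⟨marginal p, fun s y b => p s.1.1 y s.1.2 b / marginal p s.1.1 s.1.2⟩

variable (S) in
open Classical in
/-- The map `Λ⁻¹` from behaviours to Bell correlations: `p(a,b|x,y) = r(a|x) q(b|[a|x],y)` if
`r(a|x) > 0`, and `p(a,b|x,y) = 0` otherwise. -/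
def toBell (t : S.IndexedVec) : S.CorrVec :=
  fun x y a b => if h : 0 < t.1 x a then t.1 x a * t.2 ⟨⟨x, a⟩, h⟩ y b else 0

end BellScenario

end

end BellContextuality

/-!
On vectors, `Λ` divides by Alice's marginal and `Λ⁻¹` multiplies by it. The two are mutually
inverse as long as a correlation vanishes wherever the marginal does and the behaviour is
normalised (`toBell_toContextuality`, `toContextuality_toBell`). So it remains to show that each map
carries a model of the one kind into a model of the other kind (`bijOn_and_invOn`). For the
non-signalling and contextual sets this is a computation: the preparation equivalences of `NS(r)`
say that Bob's marginal does not depend on `x`.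

*Local and non-contextual.* From a local model, `μ_{a|x}` is `μ` with density
`l^A(a|x,·) / p_A(a|x)`; these mix to `μ`. Conversely, the common mixture
`μ = ∑ₐ r(a|x) μ_{a|x}` dominates every `μ_{a|x}`, and Alice's response functions are the densities
of `r(a|x) μ_{a|x}`, which add up to one almost everywhere.

*Quantum.* From a quantum spatial model, Bob's states are the normalised partial traces of
`(M ⊗ 1) ρ`. The expectation functional of `ρ` has the form `X ↦ ∑ₖ ⟨ψₖ, X ψₖ⟩`, because the trace
of `X ρ` does not depend on the basis (`hasSum_inner_comp_sqrt`). Such a functional `τ` is normal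
(`tendsto_normalFunctional`), which makes the operator with matrix elements `τ (M ⊗ |v⟩⟨u|)` a
partial trace: `Tr (N σ) = τ (M ⊗ N)` for all `N` (`hasTrace_comp_partialTrace`).

Conversely, the operators `T = r(a|x) ρ_{a|x}` add up over `a` to one density operator `σ`,
independent of `x`. Let `C` be a complex conjugation and `w = C √σ`. Since `T ≤ σ`, there is a
contraction `D` with `D w = C √T`, and on the closure of the range of `w` the operators `D* D` form
a POVM with `⟨w u, D* D w v⟩ = ⟨v, T u⟩` (`exists_povm_of_decomposition`). In the purification
`ψ = ∑ᵢ w(eᵢ) ⊗ eᵢ` of `σ` this POVM prepares the operators `T`: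
`⟨ψ, (D* D ⊗ N) ψ⟩ = Tr (N T)` (`exists_steering`).
-/

namespace BellContextuality

/-! ### The map and its inverse on vectors -/

namespace BellScenario

variable {S : BellScenario}

/-- A sum over the preparations with first label `x` is a sum over Alice's outcomes for `x`. -/
theorem sum_prep_fst_eq {E : Type*} [AddCommMonoid E] (r : S.MargVec) (x : Fin S.X)
    (F : Prep r → E) [∀ a, Decidable (0 < r x a)] :
    ∑ s, (if s.1.1 = x then F s else 0) =
      ∑ a, if h : 0 < r x a then F ⟨⟨x, a⟩, h⟩ else 0 := by
  classical
  let g : (x : Fin S.X) × Fin (S.A x) → E :=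
    fun s => if h : 0 < r s.1 s.2 then (if s.1 = x then F ⟨s, h⟩ else 0) else 0
  have h1 : ∑ s, (if s.1.1 = x then F s else 0) = ∑ s, g s := by
    have h0 : ∑ s : {s : (x : Fin S.X) × Fin (S.A x) // ¬ 0 < r s.1 s.2}, g s.1 = 0 :=
      Finset.sum_eq_zero fun s _ => dif_neg s.2
    rw [← Fintype.sum_subtype_add_sum_subtype (fun s => 0 < r s.1 s.2) g, h0, add_zero]
    refine Finset.sum_congr ?_ fun s _ => by simp only [g, dif_pos s.2]
    ext s
    simp
  rw [h1, Fintype.sum_sigma, Finset.sum_eq_single x]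
  · exact Finset.sum_congr rfl fun a _ => by simp only [g]; congr 1
  · intro x' _ hx'
    simp [g, hx']
  · simp

/-- The value of the mixture `∑ₐ r(a|x) P_{a|x}` in a real vector space. -/
theorem sum_mixture_smul {E : Type*} [AddCommGroup E] [Module ℝ E] (r : S.MargVec) (x : Fin S.X)
    (F : Prep r → E) [∀ a, Decidable (0 < r x a)] :
    ∑ s, mixture r x s • F s =
      ∑ a, if h : 0 < r x a then r x a • F ⟨⟨x, a⟩, h⟩ else 0 := by
  rw [← sum_prep_fst_eq r x (fun s => r s.1.1 s.1.2 • F s)]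
  exact Finset.sum_congr rfl fun s _ => by unfold mixture; split_ifs <;> simp

theorem marginal_isMarginal {p : S.CorrVec} (hp : IsCorrelation p) : IsMarginal (marginal p) :=
  fun x => ⟨fun _ => Finset.sum_nonneg fun _ _ => hp.nonneg _ _ _ _, hp.sum_eq_one x _⟩

/-- Where Alice's marginal vanishes, so does the correlation. -/
theorem eq_zero_of_marginal_eq_zero {p : S.CorrVec} (hp : p ∈ S.nonSignalling) {x : Fin S.X}
    {a : Fin (S.A x)} (h : ¬ 0 < marginal p x a) (y : Fin S.Y) (b : Fin (S.B y)) :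
    p x y a b = 0 := by
  have h0 : ∑ b, p x y a b = 0 := by
    rw [← marginal_eq hp]
    exact le_antisymm (not_lt.mp h) ((marginal_isMarginal hp.1 x).1 a)
  exact (Finset.sum_eq_zero_iff_of_nonneg fun _ _ => hp.1.nonneg _ _ _ _).mp h0 b (by simp)

theorem toBell_toContextuality {p : S.CorrVec} (hp : p ∈ S.nonSignalling) :
    S.toBell (S.toContextuality p) = p := by
  funext x y a b
  unfold toBell toContextuality
  dsimp only
  split_ifs with h
  · exact mul_div_cancel₀ _ h.ne'
  · exact (eq_zero_of_marginal_eq_zero hp h y b).symm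

/-- Summing over Bob's outcomes in `Λ⁻¹ (r, q)` gives back `r`. -/
theorem sum_toBell {t : S.IndexedVec} (hr : IsMarginal t.1) (hq : ∀ s y, ∑ b, t.2 s y b = 1)
    (x : Fin S.X) (y : Fin S.Y) (a : Fin (S.A x)) : ∑ b, S.toBell t x y a b = t.1 x a := by
  unfold toBell
  by_cases h : 0 < t.1 x a
  · simp [h, ← Finset.mul_sum, hq]
  · simpa [h] using le_antisymm ((hr x).1 a) (not_lt.mp h)

theorem toContextuality_toBell {t : S.IndexedVec} (hr : IsMarginal t.1)
    (hq : ∀ s y, ∑ b, t.2 s y b = 1) : S.toContextuality (S.toBell t) = t := by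
  obtain ⟨r, q⟩ := t
  have key : ∀ r' : S.MargVec, r' = r →
      (⟨r', fun s y b => S.toBell ⟨r, q⟩ s.1.1 y s.1.2 b / r' s.1.1 s.1.2⟩ : S.IndexedVec) =
        ⟨r, q⟩ := by
    rintro _ rfl
    congr 1
    funext s y b
    have hs := s.2
    simp only [toBell, hs, dif_pos]
    exact mul_div_cancel_left₀ _ hs.ne'
  exact key _ (funext fun x => funext fun a => sum_toBell hr hq x _ a)

/-- For each outcome of Bob, the mixture of the conditional probabilities of `Λ p` is Bob's
marginal of `p`. -/
theorem sum_mixture_mul_toContextuality {p : S.CorrVec} (hp : p ∈ S.nonSignalling) (x : Fin S.X)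
    (y : Fin S.Y) (b : Fin (S.B y)) :
    ∑ s, mixture (marginal p) x s * (S.toContextuality p).2 s y b = ∑ a, p x y a b := by
  classical
  have := sum_mixture_smul (marginal p) x (fun s => (S.toContextuality p).2 s y b)
  simp only [smul_eq_mul] at this
  rw [this]
  refine Finset.sum_congr rfl fun a _ => ?_
  split_ifs with h
  · exact mul_div_cancel₀ _ h.ne'
  · exact (eq_zero_of_marginal_eq_zero hp h y b).symm

theorem sum_toBell_eq_sum_mixture (t : S.IndexedVec) (x : Fin S.X)
    (y : Fin S.Y) (b : Fin (S.B y)) :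
    ∑ a, S.toBell t x y a b = ∑ s, mixture t.1 x s * t.2 s y b := by
  classical
  have := sum_mixture_smul t.1 x (fun s => t.2 s y b)
  simp only [smul_eq_mul] at this
  rw [this]
  exact Finset.sum_congr rfl fun a _ => by unfold toBell; congr 1

theorem mapsTo_toContextuality_nonSignalling :
    Set.MapsTo S.toContextuality S.nonSignalling S.contextualFamily := by
  intro p hp
  have hr := marginal_isMarginal hp.1
  refine ⟨hr, fun s y b => div_nonneg (hp.1.nonneg _ _ _ _) ((hr _).1 _), fun s y => ?_, ?_⟩
  · have : ∑ b, p s.1.1 y s.1.2 b / marginal p s.1.1 s.1.2 = 1 := by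
      rw [← Finset.sum_div, ← marginal_eq hp]
      exact div_self s.2.ne'
    exact this
  · rintro _ ⟨x, x', rfl⟩ y b
    exact (sum_mixture_mul_toContextuality hp x y b).trans
      ((hp.2.2 y b x x').trans (sum_mixture_mul_toContextuality hp x' y b).symm)

theorem mapsTo_toBell_contextualFamily :
    Set.MapsTo S.toBell S.contextualFamily S.nonSignalling := by
  rintro t ⟨hr, h0, h1, h2⟩
  refine ⟨⟨fun x y a b => ?_, fun x y => ?_⟩, fun x a y y' => ?_, fun y b x x' => ?_⟩
  · unfold toBell
    split_ifs with h
    · exact mul_nonneg h.le (h0 _ _ _)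
    · exact le_rfl
  · simp only [sum_toBell hr h1]
    exact (hr x).2
  · rw [sum_toBell hr h1, sum_toBell hr h1]
  · rw [sum_toBell_eq_sum_mixture, sum_toBell_eq_sum_mixture]
    exact h2 _ ⟨x, x', rfl⟩ y b

/-- `Λ` and `Λ⁻¹` restrict to mutually inverse bijections between a set of non-signalling
correlations and a set of normalised indexed behaviours as soon as each maps the one set into the
other. -/
theorem bijOn_and_invOn {P : Set S.CorrVec} {Q : Set S.IndexedVec}
    (hP : P ⊆ S.nonSignalling)
    (hQ : ∀ t ∈ Q, IsMarginal t.1 ∧ ∀ s y, ∑ b, t.2 s y b = 1)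
    (h : Set.MapsTo S.toContextuality P Q) (h' : Set.MapsTo S.toBell Q P) :
    Set.BijOn S.toContextuality P Q ∧ Set.InvOn S.toBell S.toContextuality P Q := by
  have hinv : Set.InvOn S.toBell S.toContextuality P Q :=
    ⟨fun p hp => toBell_toContextuality (hP hp),
      fun t ht => toContextuality_toBell (hQ t ht).1 (hQ t ht).2⟩
  exact ⟨hinv.bijOn h h', hinv⟩

end BellScenario

/-! ### Local correlations and non-contextual behaviours -/

namespace IsResponse

variable {L : Type} [MeasurableSpace L] {n m : ℕ} {ξ : Fin n → L → ℝ} {η : Fin m → L → ℝ}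

theorem le_one (hξ : IsResponse ξ) (b : Fin n) (l : L) : ξ b l ≤ 1 :=
  hξ.sum_eq_one l ▸ Finset.single_le_sum (fun b _ => hξ.nonneg b l) (Finset.mem_univ b)

theorem norm_le_one (hξ : IsResponse ξ) (b : Fin n) (l : L) : ‖ξ b l‖ ≤ 1 := by
  rw [Real.norm_of_nonneg (hξ.nonneg b l)]
  exact hξ.le_one b l

theorem integrable (hξ : IsResponse ξ) (μ : Measure L) [IsFiniteMeasure μ] (b : Fin n) :
    Integrable (ξ b) μ :=
  Integrable.of_bound (hξ.measurable b).aestronglyMeasurable 1 (.of_forall (hξ.norm_le_one b))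

theorem integrable_mul (hξ : IsResponse ξ) (hη : IsResponse η) (μ : Measure L)
    [IsFiniteMeasure μ] (a : Fin n) (b : Fin m) : Integrable (fun l => ξ a l * η b l) μ :=
  (hη.integrable μ b).bdd_mul (hξ.measurable a).aestronglyMeasurable
    (.of_forall (hξ.norm_le_one a))

theorem sum_integral_mul (hξ : IsResponse ξ) (hη : IsResponse η) (μ : Measure L)
    [IsFiniteMeasure μ] (a : Fin n) : ∑ b, ∫ l, ξ a l * η b l ∂μ = ∫ l, ξ a l ∂μ := by
  rw [← integral_finsetSum _ fun b _ => hξ.integrable_mul hη μ a b]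
  simp only [← Finset.mul_sum, hη.sum_eq_one, mul_one]

theorem sum_integral (hξ : IsResponse ξ) (μ : Measure L) [IsFiniteMeasure μ] :
    ∑ b, ∫ l, ξ b l ∂μ = μ.real Set.univ := by
  rw [← integral_finsetSum _ fun b _ => hξ.integrable μ b]
  simp [hξ.sum_eq_one]

end IsResponse

namespace BellScenario

variable {S : BellScenario}

theorem localSet_subset_nonSignalling : S.localSet ⊆ S.nonSignalling := by
  rintro p ⟨L, _, μ, _, lA, lB, hA, hB, hp⟩
  have h1 : ∀ x y a, ∑ b, p x y a b = ∫ l, lA x a l ∂μ := fun x y a => by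
    simp only [hp]
    exact (hA x).sum_integral_mul (hB y) μ a
  have h2 : ∀ x y b, ∑ a, p x y a b = ∫ l, lB y b l ∂μ := fun x y b => by
    simp only [hp, mul_comm (lA x _ _)]
    exact (hB y).sum_integral_mul (hA x) μ b
  refine ⟨⟨fun x y a b => ?_, fun x y => ?_⟩, fun x a y y' => ?_, fun y b x x' => ?_⟩
  · rw [hp]
    exact integral_nonneg fun l => mul_nonneg ((hA x).nonneg a l) ((hB y).nonneg b l)
  · simp only [h1, (hA x).sum_integral, probReal_univ]
  · rw [h1, h1]
  · rw [h2, h2]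

/-- A local model becomes a non-contextual one with the same ontic space and Bob's response
functions, the epistemic states being reweighted by Alice's. -/
theorem mapsTo_toContextuality_localSet :
    Set.MapsTo S.toContextuality S.localSet S.nonContextualFamily := by
  classical
  intro p hloc
  have hns := localSet_subset_nonSignalling hloc
  obtain ⟨L, mL, μ, _, lA, lB, hA, hB, hp⟩ := hloc
  have hr : ∀ x a, marginal p x a = ∫ l, lA x a l ∂μ := fun x a => by
    simp only [marginal, hp]
    exact (hA x).sum_integral_mul (hB _) μ a
  -- `μ_{a|x}` has density `l^A(a|x,·) / p_A(a|x)` with respect to `μ`.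
  let d : Prep (marginal p) → L → NNReal :=
    fun s l => Real.toNNReal (lA s.1.1 s.1.2 l / marginal p s.1.1 s.1.2)
  have hdm : ∀ s, Measurable (d s) := fun s =>
    (((hA s.1.1).measurable s.1.2).div_const _).real_toNNReal
  have hd : ∀ s l, (d s l : ℝ) = lA s.1.1 s.1.2 l / marginal p s.1.1 s.1.2 := fun s l =>
    Real.coe_toNNReal _ (div_nonneg ((hA _).nonneg _ _) s.2.le)
  let ν : Prep (marginal p) → Measure L := fun s => μ.withDensity fun l => (d s l : ENNReal)
  have hint : ∀ s (f : L → ℝ), ∫ l, f l ∂(ν s) =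
      (∫ l, lA s.1.1 s.1.2 l * f l ∂μ) / marginal p s.1.1 s.1.2 := fun s f => by
    rw [integral_withDensity_eq_integral_smul (hdm s), ← integral_div]
    refine integral_congr_ae (.of_forall fun l => ?_)
    change (d s l : ℝ) * f l = _
    rw [hd]
    ring
  have hset : ∀ s E, MeasurableSet E → (ν s).real E =
      (∫ l in E, lA s.1.1 s.1.2 l ∂μ) / marginal p s.1.1 s.1.2 := fun s E hE => by
    rw [← integral_indicator_one hE, hint, ← integral_indicator hE]
    congr 2
    funext l
    by_cases hl : l ∈ E <;> simp [hl]
  have hν : ∀ s, IsProbabilityMeasure (ν s) := fun s => by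
    have h1 : (ν s).real Set.univ = 1 := by
      rw [hset s _ .univ, setIntegral_univ, ← hr, div_self s.2.ne']
    exact ⟨by rw [← ENNReal.toReal_eq_one_iff]; exact h1⟩
  have hmix : ∀ x E, MeasurableSet E →
      ∑ s, mixture (marginal p) x s * (ν s).real E = μ.real E := fun x E hE => by
    have := sum_mixture_smul (marginal p) x (fun s => (ν s).real E)
    simp only [smul_eq_mul] at this
    have h1 : μ.real E = ∫ l in E, ∑ a, lA x a l ∂μ := by
      simp only [(hA x).sum_eq_one, setIntegral_one_eq_measureReal]
    rw [this, h1, integral_finsetSum _ fun a _ => ((hA x).integrable μ a).integrableOn]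
    refine Finset.sum_congr rfl fun a _ => ?_
    split_ifs with h
    · rw [hset _ E hE]
      exact mul_div_cancel₀ _ h.ne'
    · refine (le_antisymm ?_ (integral_nonneg fun l => (hA x).nonneg a l)).symm
      refine (setIntegral_le_integral ((hA x).integrable μ a)
        (.of_forall fun l => (hA x).nonneg a l)).trans ?_
      rw [← hr]
      exact not_lt.mp h
  refine ⟨marginal_isMarginal hns.1, L, mL, (ν : Prep (S.toContextuality p).1 → Measure L),
    lB, hν, hB, ?_, fun s y b => ?_⟩
  · rintro _ ⟨x, x', rfl⟩ E hE
    exact (hmix x E hE).trans (hmix x' E hE).symm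
  · exact (congrArg (· / marginal p s.1.1 s.1.2) (hp s.1.1 y s.1.2 b)).trans (hint s _).symm

theorem nonContextualFamily_normalised {t : S.IndexedVec} (ht : t ∈ S.nonContextualFamily) :
    IsMarginal t.1 ∧ ∀ s y, ∑ b, t.2 s y b = 1 := by
  obtain ⟨hr, L, _, μ, ξ, hμ, hξ, -, hq⟩ := ht
  refine ⟨hr, fun s y => ?_⟩
  have := hμ s
  simp only [hq, (hξ y).sum_integral, probReal_univ]

/-- A non-contextual model becomes a local one on the common mixture `μ = ∑ₐ r(a|x) μ_{a|x}`, with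
the Radon–Nikodym derivatives of `r(a|x) μ_{a|x}` as Alice's response functions. -/
theorem mapsTo_toBell_nonContextualFamily :
    Set.MapsTo S.toBell S.nonContextualFamily S.localSet := by
  classical
  rintro ⟨r, q⟩ ⟨hr, L, mL, ν, ξ, hν, hξ, heq, hq⟩
  change IsMarginal r at hr
  change Prep r → Measure L at ν
  change ∀ s y b, q s y b = _ at hq
  have hmn : ∀ x s, 0 ≤ mixture r x s := fun x => (mixture_mem_stdSimplex hr x).1
  let x₀ : Fin S.X := ⟨0, S.X_pos⟩
  let μ : Measure L := ∑ s, ENNReal.ofReal (mixture r x₀ s) • ν s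
  have hμE : ∀ x E, MeasurableSet E → μ.real E = ∑ s, mixture r x s * (ν s).real E := by
    intro x E hE
    refine Eq.trans ?_ (heq _ ⟨x₀, x, rfl⟩ E hE)
    simp only [μ, measureReal_def, Measure.finsetSum_apply, Measure.smul_apply, smul_eq_mul]
    rw [ENNReal.toReal_sum fun s _ => ENNReal.mul_ne_top ENNReal.ofReal_ne_top
      (measure_ne_top _ _)]
    exact Finset.sum_congr rfl fun s _ => by
      rw [ENNReal.toReal_mul, ENNReal.toReal_ofReal (hmn _ _)]
  have hfin : IsFiniteMeasure μ := ⟨by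
    simp only [μ, Measure.finsetSum_apply, Measure.smul_apply, smul_eq_mul]
    exact ENNReal.sum_lt_top.mpr fun s _ => ENNReal.mul_lt_top ENNReal.ofReal_lt_top
      (measure_lt_top _ _)⟩
  have hprob : IsProbabilityMeasure μ := by
    have h1 : μ.real Set.univ = 1 := by
      rw [hμE x₀ _ .univ]
      simpa using (mixture_mem_stdSimplex hr x₀).2
    exact ⟨by rw [← ENNReal.toReal_eq_one_iff]; exact h1⟩
  have hac : ∀ s, ν s ≪ μ := fun s => by
    refine Measure.AbsolutelyContinuous.mk fun E hE h0 => ?_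
    have h1 : ∑ s', mixture r s.1.1 s' * (ν s').real E = 0 := by
      rw [← hμE _ E hE, measureReal_def, h0, ENNReal.toReal_zero]
    have h2 := (Finset.sum_eq_zero_iff_of_nonneg fun s' _ =>
      mul_nonneg (hmn _ s') measureReal_nonneg).mp h1 s (by simp)
    have h3 : mixture r s.1.1 s ≠ 0 := by
      unfold mixture
      rw [if_pos rfl]
      exact s.2.ne'
    exact (measureReal_eq_zero_iff).mp ((mul_eq_zero.mp h2).resolve_left h3)
  let g : (x : Fin S.X) → Fin (S.A x) → L → ℝ := fun x a l =>
    if h : 0 < r x a then r x a * ((ν ⟨⟨x, a⟩, h⟩).rnDeriv μ l).toReal else 0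
  have hgm : ∀ x a, Measurable (g x a) := fun x a => by
    by_cases h : 0 < r x a
    · simp only [g, h, dif_pos]
      exact ((Measure.measurable_rnDeriv _ _).ennreal_toReal).const_mul _
    · simp only [g, h, dif_neg, not_false_eq_true]
      exact measurable_const
  have hg0 : ∀ x a l, 0 ≤ g x a l := fun x a l => by
    simp only [g]
    split_ifs with h
    · exact mul_nonneg h.le ENNReal.toReal_nonneg
    · exact le_rfl
  have hsum : ∀ x, ∀ᵐ l ∂μ, ∑ a, g x a l = 1 := by
    intro x
    have hg : ∀ l, ∑ a, g x a l = ∑ s, mixture r x s * ((ν s).rnDeriv μ l).toReal := fun l =>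
      (sum_mixture_smul r x (fun s => ((ν s).rnDeriv μ l).toReal)).symm
    simp only [hg]
    have hi : ∀ s, Integrable (fun l => mixture r x s * ((ν s).rnDeriv μ l).toReal) μ := fun s =>
      Measure.integrable_toReal_rnDeriv.const_mul _
    refine Integrable.ae_eq_of_forall_setIntegral_eq _ _
      (integrable_finsetSum _ fun s _ => hi s) (integrable_const 1) fun E hE _ => ?_
    rw [integral_finsetSum _ fun s _ => (hi s).integrableOn, setIntegral_one_eq_measureReal,
      hμE x E hE]
    refine Finset.sum_congr rfl fun s _ => ?_
    rw [integral_const_mul, Measure.setIntegral_toReal_rnDeriv (hac s)]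
  -- Alice's response functions are the densities, except on the null set where the densities fail
  -- to add up to one; there they are a fixed deterministic response.
  have hne : ∀ x, ∃ a : Fin (S.A x), True := fun x => by
    by_contra hcon
    push Not at hcon
    have := (hr x).2
    rw [Finset.sum_eq_zero fun a _ => (hcon a).elim] at this
    exact zero_ne_one this
  choose a₀ _ using hne
  let lA : (x : Fin S.X) → Fin (S.A x) → L → ℝ := fun x a l =>
    if ∑ a', g x a' l = 1 then g x a l else if a = a₀ x then 1 else 0
  have hlA : ∀ x a, lA x a =ᵐ[μ] g x a := fun x a => by
    filter_upwards [hsum x] with l hl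
    simp only [lA, hl, if_true]
  refine ⟨L, mL, μ, hprob, lA, ξ, fun x => ⟨fun a => ?_, fun a l => ?_, fun l => ?_⟩, hξ,
    fun x y a b => ?_⟩
  · refine Measurable.ite ?_ (hgm x a) measurable_const
    exact measurableSet_eq_fun (Finset.measurable_sum _ fun a _ => hgm x a) measurable_const
  · simp only [lA]
    split_ifs
    exacts [hg0 x a l, zero_le_one, le_rfl]
  · by_cases h : ∑ a', g x a' l = 1
    · simp [lA, h]
    · simp [lA, h]
  · have h1 : ∫ l, lA x a l * ξ y b l ∂μ = ∫ l, g x a l * ξ y b l ∂μ :=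
      integral_congr_ae (by filter_upwards [hlA x a] with l hl; rw [hl])
    rw [h1]
    unfold toBell
    dsimp only
    split_ifs with h
    · simp only [g, h, dif_pos, mul_assoc, integral_const_mul, hq]
      congr 1
      exact (integral_rnDeriv_smul (hac ⟨⟨x, a⟩, h⟩)).symm
    · simp only [g, h, dif_neg, not_false_eq_true, zero_mul, integral_zero]

end BellScenario

/-! ### Traces of products with a positive operator -/

section Trace

variable {H : Type} [NormedAddCommGroup H] [InnerProductSpace ℂ H]

theorem hasSum_norm_inner_sq {ι : Type} (e : HilbertBasis ι ℂ H) (x : H) :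
    HasSum (fun i => ‖⟪e i, x⟫_ℂ‖ ^ 2) (‖x‖ ^ 2) := by
  have h := (e.hasSum_inner_mul_inner x x).mapL Complex.reCLM
  rw [← inner_self_eq_norm_sq (𝕜 := ℂ) x]
  refine h.congr_fun ?_
  intro i
  rw [← inner_conj_symm x (e i), mul_comm, RCLike.mul_conj]
  norm_cast

variable (H) in
theorem exists_hilbertBasis_type [CompleteSpace H] :
    ∃ (ι : Type) (_ : HilbertBasis ι ℂ H), True :=
  let ⟨w, b, _⟩ := exists_hilbertBasis ℂ H
  ⟨w, b, trivial⟩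

theorem HasTrace.add {T T' : H →L[ℂ] H} {t t' : ℂ} (h : HasTrace T t) (h' : HasTrace T' t') :
    HasTrace (T + T') (t + t') := fun ι e => by
  simpa [inner_add_right] using (h ι e).add (h' ι e)

theorem HasTrace.smul {T : H →L[ℂ] H} {t : ℂ} (c : ℂ) (h : HasTrace T t) :
    HasTrace (c • T) (c * t) := fun ι e => by
  simpa [inner_smul_right] using (h ι e).mul_left c

theorem HasTrace.zero : HasTrace (0 : H →L[ℂ] H) 0 := fun ι e => by
  simp [hasSum_zero]

theorem HasTrace.sum {α : Type*} (s : Finset α) {T : α → H →L[ℂ] H} {t : α → ℂ}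
    (h : ∀ a ∈ s, HasTrace (T a) (t a)) : HasTrace (∑ a ∈ s, T a) (∑ a ∈ s, t a) := by
  classical
  induction s using Finset.induction_on with
  | empty => simpa using HasTrace.zero
  | insert a s ha ih =>
    rw [Finset.sum_insert ha, Finset.sum_insert ha]
    exact (h a (by simp)).add (ih fun b hb => h b (by simp [hb]))

variable [CompleteSpace H]

theorem HasTrace.unique {T : H →L[ℂ] H} {t t' : ℂ} (h : HasTrace T t) (h' : HasTrace T t') :
    t = t' := by
  obtain ⟨ι, e, -⟩ := exists_hilbertBasis_type H
  exact (h ι e).unique (h' ι e)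

/-- A positive operator has a positive square root. -/
theorem exists_isPositive_sqrt {T : H →L[ℂ] H} (hT : T.IsPositive) :
    ∃ R : H →L[ℂ] H, R.IsPositive ∧ ∀ x, R (R x) = T x := by
  have h0 : 0 ≤ T := (ContinuousLinearMap.nonneg_iff_isPositive T).mpr hT
  refine ⟨CFC.sqrt T,
    (ContinuousLinearMap.nonneg_iff_isPositive _).mp (CFC.sqrt_nonneg T), fun x => ?_⟩
  rw [← mul_apply_eq_comp, CFC.sqrt_mul_sqrt_self T h0]

omit [CompleteSpace H] in
theorem inner_sqrt_sqrt {R T : H →L[ℂ] H} (hR : R.IsPositive) (hRR : ∀ x, R (R x) = T x)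
    (x y : H) : ⟪R x, R y⟫_ℂ = ⟪x, T y⟫_ℂ := by
  rw [← hRR]
  exact hR.isSymmetric x (R y)

omit [CompleteSpace H] in
/-- The sum of `‖√T f_j‖²` is the trace of `T`. -/
theorem hasSum_norm_sqrt_sq {R T : H →L[ℂ] H} (hR : R.IsPositive) (hRR : ∀ x, R (R x) = T x)
    {t : ℂ} (ht : HasTrace T t) {κ : Type} (f : HilbertBasis κ ℂ H) :
    HasSum (fun j => ‖R (f j)‖ ^ 2) t.re := by
  refine ((ht κ f).mapL Complex.reCLM).congr_fun fun j => ?_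
  rw [← inner_self_eq_norm_sq (𝕜 := ℂ), inner_sqrt_sqrt hR hRR]
  rfl

/-- Exchange of the order of summation in an absolutely summable double series. -/
theorem hasSum_exchange {ι κ : Type} {c : κ → ι → ℂ} (hc : Summable fun p : κ × ι => c p.1 p.2)
    {A : κ → ℂ} {B : ι → ℂ} (hA : ∀ j, HasSum (c j) (A j))
    (hB : ∀ i, HasSum (fun j => c j i) (B i)) : HasSum B (∑' j, A j) := by
  have h := hc.hasSum.prod_fiberwise hA
  rw [h.tsum_eq]
  exact ((Equiv.prodComm ι κ).hasSum_iff.mpr hc.hasSum).prod_fiberwise hB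

omit [CompleteSpace H] in
theorem summable_norm_inner_sq_prod {ι κ : Type} (e : HilbertBasis ι ℂ H) {w : κ → H}
    (hw : Summable fun j => ‖w j‖ ^ 2) :
    Summable fun p : κ × ι => ‖⟪e p.2, w p.1⟫_ℂ‖ ^ 2 := by
  refine (summable_prod_of_nonneg fun p => sq_nonneg _).mpr ⟨fun j => ?_, ?_⟩
  · exact (hasSum_norm_inner_sq e (w j)).summable
  · change Summable fun j => ∑' i, ‖⟪e i, w j⟫_ℂ‖ ^ 2
    simpa only [fun j => (hasSum_norm_inner_sq e (w j)).tsum_eq] using hw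

omit [CompleteSpace H] in
theorem summable_inner_mul_inner_prod {ι κ : Type} (e : HilbertBasis ι ℂ H) {v w : κ → H}
    (hv : Summable fun j => ‖v j‖ ^ 2) (hw : Summable fun j => ‖w j‖ ^ 2) :
    Summable fun p : κ × ι => ⟪v p.1, e p.2⟫_ℂ * ⟪e p.2, w p.1⟫_ℂ := by
  refine Summable.of_norm_bounded
    ((summable_norm_inner_sq_prod e hv).add (summable_norm_inner_sq_prod e hw)) fun p => ?_
  rw [norm_mul, norm_inner_symm]
  generalize ‖⟪e p.2, v p.1⟫_ℂ‖ = x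
  generalize ‖⟪e p.2, w p.1⟫_ℂ‖ = y
  nlinarith [sq_nonneg (x - y), sq_nonneg x, sq_nonneg y]

/-- For a Hilbert–Schmidt operator `R ≥ 0`, the trace of `X R²` exists in every basis and can be
computed as `∑ⱼ ⟨R fⱼ, X R fⱼ⟩` in any other basis: both are iterated sums of the absolutely
summable family `⟨R fⱼ, eᵢ⟩ ⟨eᵢ, X R fⱼ⟩`. -/
theorem hasSum_inner_comp_sqrt {R T : H →L[ℂ] H} (hR : R.IsPositive) (hRR : ∀ x, R (R x) = T x)
    (X : H →L[ℂ] H) {ι κ : Type} (e : HilbertBasis ι ℂ H) (f : HilbertBasis κ ℂ H)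
    (hf : Summable fun j => ‖R (f j)‖ ^ 2) :
    HasSum (fun i => ⟪e i, X (T (e i))⟫_ℂ) (∑' j, ⟪R (f j), X (R (f j))⟫_ℂ) := by
  have hsymm : ∀ x y, ⟪R x, y⟫_ℂ = ⟪x, R y⟫_ℂ := fun x y => hR.isSymmetric x y
  have hXR : Summable fun j => ‖X (R (f j))‖ ^ 2 := by
    refine Summable.of_nonneg_of_le (fun j => sq_nonneg _) (fun j => ?_)
      (hf.mul_left (‖X‖ ^ 2))
    rw [← mul_pow]
    exact pow_le_pow_left₀ (norm_nonneg _) (X.le_opNorm _) 2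
  have h1 : ∀ i j, ⟪R (X.adjoint (e i)), f j⟫_ℂ = ⟪e i, X (R (f j))⟫_ℂ := fun i j =>
    (hsymm _ _).trans (ContinuousLinearMap.adjoint_inner_left X (R (f j)) (e i))
  have h2 : ∀ i j, ⟪f j, R (e i)⟫_ℂ = ⟪R (f j), e i⟫_ℂ := fun i j => (hsymm _ _).symm
  have h3 : ∀ i, ⟪R (X.adjoint (e i)), R (e i)⟫_ℂ = ⟪e i, X (T (e i))⟫_ℂ := fun i =>
    (inner_sqrt_sqrt hR hRR _ _).trans (ContinuousLinearMap.adjoint_inner_left X (T (e i)) (e i))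
  have hA : ∀ j, HasSum (fun i => ⟪R (f j), e i⟫_ℂ * ⟪e i, X (R (f j))⟫_ℂ)
      ⟪R (f j), X (R (f j))⟫_ℂ := fun j => e.hasSum_inner_mul_inner (R (f j)) (X (R (f j)))
  have hB : ∀ i, HasSum (fun j => ⟪R (f j), e i⟫_ℂ * ⟪e i, X (R (f j))⟫_ℂ)
      ⟪e i, X (T (e i))⟫_ℂ := fun i => by
    have h := f.hasSum_inner_mul_inner (R (X.adjoint (e i))) (R (e i))
    simpa only [h1, h2, h3, mul_comm] using h
  have hc : Summable fun p : κ × ι => ⟪R (f p.1), e p.2⟫_ℂ * ⟪e p.2, X (R (f p.1))⟫_ℂ :=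
    summable_inner_mul_inner_prod (v := fun j => R (f j)) (w := fun j => X (R (f j))) e hf hXR
  exact hasSum_exchange (c := fun j i => ⟪R (f j), e i⟫_ℂ * ⟪e i, X (R (f j))⟫_ℂ) hc hA hB

theorem HasTrace.comp_left {R T : H →L[ℂ] H} (hR : R.IsPositive) (hRR : ∀ x, R (R x) = T x)
    {t : ℂ} (ht : HasTrace T t) (X : H →L[ℂ] H) {κ : Type} (f : HilbertBasis κ ℂ H) :
    HasTrace (X ∘L T) (∑' j, ⟪R (f j), X (R (f j))⟫_ℂ) := fun _ e =>
  hasSum_inner_comp_sqrt hR hRR X e f (hasSum_norm_sqrt_sq hR hRR ht f).summable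

/-- A positive operator of trace zero vanishes. -/
theorem eq_zero_of_hasTrace_zero {T : H →L[ℂ] H} (hT : T.IsPositive) (h : HasTrace T 0) :
    T = 0 := by
  obtain ⟨ι, e, -⟩ := exists_hilbertBasis_type H
  obtain ⟨R, hR, hRR⟩ := exists_isPositive_sqrt hT
  have h0 := (hasSum_zero_iff_of_nonneg fun j => by positivity).mp (hasSum_norm_sqrt_sq hR hRR h e)
  have h1 : R = 0 := by
    refine ContinuousLinearMap.ext_on
      (Submodule.dense_iff_topologicalClosure_eq_top.mpr e.dense_span) ?_
    rintro _ ⟨j, rfl⟩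
    simpa using congrFun h0 j
  ext x
  rw [← hRR, h1]
  rfl

omit [CompleteSpace H] in
/-- The trace of `N |ψ⟩⟨ψ|` is `⟨ψ, N ψ⟩`. -/
theorem hasTrace_comp_rankOne (N : H →L[ℂ] H) (ψ : H) :
    HasTrace (N ∘L InnerProductSpace.rankOne ℂ ψ ψ) ⟪ψ, N ψ⟫_ℂ := fun ι e => by
  refine (e.hasSum_inner_mul_inner ψ (N ψ)).congr_fun fun i => ?_
  simp

end Trace

/-! ### Normal functionals -/

section NormalFunctional

variable {K : Type} [NormedAddCommGroup K] [InnerProductSpace ℂ K]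

theorem norm_inner_apply_le (v : K) (X : K →L[ℂ] K) : ‖⟪v, X v⟫_ℂ‖ ≤ ‖X‖ * ‖v‖ ^ 2 := by
  calc ‖⟪v, X v⟫_ℂ‖ ≤ ‖v‖ * ‖X v‖ := norm_inner_le_norm _ _
    _ ≤ ‖v‖ * (‖X‖ * ‖v‖) := by gcongr; exact X.le_opNorm v
    _ = ‖X‖ * ‖v‖ ^ 2 := by ring

theorem summable_inner_apply {κ : Type} {v : κ → K} (hv : Summable fun k => ‖v k‖ ^ 2)
    (X : K →L[ℂ] K) : Summable fun k => ⟪v k, X (v k)⟫_ℂ :=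
  Summable.of_norm_bounded (hv.mul_left ‖X‖) fun k => norm_inner_apply_le (v k) X

/-- The functional `X ↦ ∑ₖ ⟨vₖ, X vₖ⟩` on bounded operators, for a square-summable family of
vectors. -/
noncomputable def normalFunctional {κ : Type} {v : κ → K} (hv : Summable fun k => ‖v k‖ ^ 2) :
    (K →L[ℂ] K) →ₗ[ℂ] ℂ where
  toFun X := ∑' k, ⟪v k, X (v k)⟫_ℂ
  map_add' X Y := by
    rw [← (summable_inner_apply hv X).tsum_add (summable_inner_apply hv Y)]
    simp
  map_smul' c X := by simp [tsum_mul_left]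

theorem normalFunctional_apply {κ : Type} {v : κ → K} (hv : Summable fun k => ‖v k‖ ^ 2)
    (X : K →L[ℂ] K) : normalFunctional hv X = ∑' k, ⟪v k, X (v k)⟫_ℂ := rfl

theorem norm_normalFunctional_le {κ : Type} {v : κ → K} (hv : Summable fun k => ‖v k‖ ^ 2)
    (X : K →L[ℂ] K) : ‖normalFunctional hv X‖ ≤ (∑' k, ‖v k‖ ^ 2) * ‖X‖ := by
  rw [mul_comm, ← tsum_mul_left]
  exact tsum_of_norm_bounded (hv.mul_left ‖X‖).hasSum fun k => norm_inner_apply_le (v k) X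

open scoped ComplexOrder in
theorem normalFunctional_nonneg {κ : Type} {v : κ → K} (hv : Summable fun k => ‖v k‖ ^ 2)
    {X : K →L[ℂ] K} (hX : X.IsPositive) : 0 ≤ normalFunctional hv X :=
  tsum_nonneg fun k => hX.inner_nonneg_right (v k)

/-- Normality: the functional is continuous along bounded, strongly convergent nets. -/
theorem tendsto_normalFunctional {κ α : Type} {v : κ → K} (hv : Summable fun k => ‖v k‖ ^ 2)
    {l : Filter α} {X : α → K →L[ℂ] K} {X₀ : K →L[ℂ] K} {C : ℝ} (hC : ∀ a, ‖X a‖ ≤ C)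
    (hX : ∀ ψ, Filter.Tendsto (fun a => X a ψ) l (nhds (X₀ ψ))) :
    Filter.Tendsto (fun a => normalFunctional hv (X a)) l (nhds (normalFunctional hv X₀)) := by
  simp only [normalFunctional_apply]
  refine tendsto_tsum_of_dominated_convergence (hv.mul_left C)
    (fun k => tendsto_const_nhds.inner (hX (v k))) (.of_forall fun a k => ?_)
  refine (norm_inner_apply_le (v k) (X a)).trans ?_
  gcongr
  exact hC a

end NormalFunctional

/-! ### Operators on the Hilbert space tensor product -/

section TensorOp

variable {H K : Type} [NormedAddCommGroup H] [InnerProductSpace ℂ H]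
  [NormedAddCommGroup K] [InnerProductSpace ℂ K]

variable (H K) in
/-- Simple tensors are total in the Hilbert space tensor product. -/
theorem hilbertTensor_induction {p : HilbertTensor H K → Prop} (hp : IsClosed {x | p x})
    (hadd : ∀ x y, p x → p y → p (x + y)) (htmul : ∀ x y, p ((x ⊗ₜ[ℂ] y : H ⊗[ℂ] K)))
    (z : HilbertTensor H K) : p z := by
  refine UniformSpace.Completion.induction_on z hp fun t => ?_
  induction t with
  | zero => simpa using htmul 0 0
  | tmul x y => exact htmul x y
  | add x y hx hy =>
    rw [UniformSpace.Completion.coe_add]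
    exact hadd _ _ hx hy

theorem tensorOp_tmul (M : H →L[ℂ] H) (N : K →L[ℂ] K) (x : H) (y : K) :
    tensorOp M N ((x ⊗ₜ[ℂ] y : H ⊗[ℂ] K)) = ((M x ⊗ₜ[ℂ] N y : H ⊗[ℂ] K)) := by
  rw [tensorOp, ContinuousLinearMap.completion_apply_coe, TensorProduct.mapL_tmul]

theorem inner_tmul_coe (x x' : H) (y y' : K) :
    ⟪((x ⊗ₜ[ℂ] y : H ⊗[ℂ] K) : HilbertTensor H K), ((x' ⊗ₜ[ℂ] y' : H ⊗[ℂ] K))⟫_ℂ =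
      ⟪x, x'⟫_ℂ * ⟪y, y'⟫_ℂ := by
  rw [UniformSpace.Completion.inner_coe, TensorProduct.inner_tmul]

theorem norm_tmul_coe (x : H) (y : K) :
    ‖((x ⊗ₜ[ℂ] y : H ⊗[ℂ] K) : HilbertTensor H K)‖ = ‖x‖ * ‖y‖ := by
  rw [UniformSpace.Completion.norm_coe, TensorProduct.norm_tmul]

/-- Operators that agree on simple tensors are equal. -/
theorem hilbertTensor_ext {T T' : HilbertTensor H K →L[ℂ] HilbertTensor H K}
    (h : ∀ x y, T ((x ⊗ₜ[ℂ] y : H ⊗[ℂ] K)) = T' ((x ⊗ₜ[ℂ] y : H ⊗[ℂ] K))) : T = T' := by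
  ext z
  refine hilbertTensor_induction H K (isClosed_eq T.continuous T'.continuous)
    (fun x y hx hy => ?_) h z
  rw [map_add, map_add, hx, hy]

theorem tensorOp_add_left (M M' : H →L[ℂ] H) (N : K →L[ℂ] K) :
    tensorOp (M + M') N = tensorOp M N + tensorOp M' N :=
  hilbertTensor_ext fun x y => by
    simp only [add_apply, tensorOp_tmul, TensorProduct.add_tmul,
      UniformSpace.Completion.coe_add]

theorem tensorOp_add_right (M : H →L[ℂ] H) (N N' : K →L[ℂ] K) :
    tensorOp M (N + N') = tensorOp M N + tensorOp M N' :=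
  hilbertTensor_ext fun x y => by
    simp only [add_apply, tensorOp_tmul, TensorProduct.tmul_add,
      UniformSpace.Completion.coe_add]

theorem tensorOp_smul_right (M : H →L[ℂ] H) (c : ℂ) (N : K →L[ℂ] K) :
    tensorOp M (c • N) = c • tensorOp M N :=
  hilbertTensor_ext fun x y => by
    simp only [smul_apply, tensorOp_tmul, TensorProduct.tmul_smul,
      UniformSpace.Completion.coe_smul]

theorem tensorOp_zero_left (N : K →L[ℂ] K) : tensorOp (0 : H →L[ℂ] H) N = 0 :=
  hilbertTensor_ext fun x y => by
    simp only [zero_apply, tensorOp_tmul, TensorProduct.zero_tmul,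
      UniformSpace.Completion.coe_zero]

theorem tensorOp_sum_left {α : Type*} (s : Finset α) (M : α → H →L[ℂ] H) (N : K →L[ℂ] K) :
    tensorOp (∑ a ∈ s, M a) N = ∑ a ∈ s, tensorOp (M a) N := by
  classical
  induction s using Finset.induction_on with
  | empty => simpa using tensorOp_zero_left N
  | insert a s ha ih => rw [Finset.sum_insert ha, Finset.sum_insert ha, tensorOp_add_left, ih]

theorem tensorOp_zero_right (M : H →L[ℂ] H) : tensorOp M (0 : K →L[ℂ] K) = 0 := by
  simpa using tensorOp_smul_right M 0 (0 : K →L[ℂ] K)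

theorem tensorOp_sum_right {α : Type*} (s : Finset α) (M : H →L[ℂ] H) (N : α → K →L[ℂ] K) :
    tensorOp M (∑ a ∈ s, N a) = ∑ a ∈ s, tensorOp M (N a) := by
  classical
  induction s using Finset.induction_on with
  | empty => simpa using tensorOp_zero_right M
  | insert a s ha ih => rw [Finset.sum_insert ha, Finset.sum_insert ha, tensorOp_add_right, ih]

theorem norm_tensorOp_le (M : H →L[ℂ] H) (N : K →L[ℂ] K) : ‖tensorOp M N‖ ≤ ‖M‖ * ‖N‖ := by
  refine ContinuousLinearMap.opNorm_le_bound _ (by positivity) fun z => ?_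
  refine UniformSpace.Completion.induction_on z (isClosed_le
    (tensorOp M N).continuous.norm (continuous_const.mul continuous_norm)) fun t => ?_
  rw [tensorOp, ContinuousLinearMap.completion_apply_coe, UniformSpace.Completion.norm_coe,
    UniformSpace.Completion.norm_coe]
  exact (TensorProduct.mapL M N).le_of_opNorm_le (TensorProduct.norm_mapL_le M N) t

/-- `M ⊗ N` is the square of the symmetric operator `√M ⊗ √N`. -/
theorem tensorOp_isPositive [CompleteSpace H] [CompleteSpace K] {M : H →L[ℂ] H} {N : K →L[ℂ] K}
    (hM : M.IsPositive) (hN : N.IsPositive) : (tensorOp M N).IsPositive := by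
  obtain ⟨R, hR, hRR⟩ := exists_isPositive_sqrt hM
  obtain ⟨R', hR', hRR'⟩ := exists_isPositive_sqrt hN
  have hsymm : ∀ z w, ⟪tensorOp R R' z, w⟫_ℂ = ⟪z, tensorOp R R' w⟫_ℂ := fun z w => by
    refine hilbertTensor_induction H K
      (p := fun z => ⟪tensorOp R R' z, w⟫_ℂ = ⟪z, tensorOp R R' w⟫_ℂ)
      (isClosed_eq (by fun_prop) (by fun_prop)) (fun a b ha hb => ?_) (fun x y => ?_) z
    · rw [map_add, inner_add_left, inner_add_left, ha, hb]
    refine hilbertTensor_induction H K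
      (p := fun w => ⟪tensorOp R R' _, w⟫_ℂ = ⟪_, tensorOp R R' w⟫_ℂ)
      (isClosed_eq (by fun_prop) (by fun_prop)) (fun a b ha hb => ?_) (fun x' y' => ?_) w
    · rw [map_add, inner_add_right, inner_add_right, ha, hb]
    rw [tensorOp_tmul, tensorOp_tmul, inner_tmul_coe, inner_tmul_coe]
    exact congrArg₂ _ (hR.isSymmetric x x') (hR'.isSymmetric y y')
  have hsq : ∀ z, tensorOp M N z = tensorOp R R' (tensorOp R R' z) := fun z => by
    have : tensorOp M N = tensorOp R R' ∘L tensorOp R R' := hilbertTensor_ext fun x y => by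
      rw [ContinuousLinearMap.comp_apply, tensorOp_tmul, tensorOp_tmul, tensorOp_tmul, hRR, hRR']
    rw [this]
    rfl
  have h : ∀ z, ⟪tensorOp M N z, z⟫_ℂ = ((‖tensorOp R R' z‖ ^ 2 : ℝ) : ℂ) := fun z => by
    rw [hsq, hsymm, inner_self_eq_norm_sq_to_K]
    norm_cast
  refine ContinuousLinearMap.isPositive_iff_complex _ |>.mpr fun z => ?_
  rw [h]
  exact ⟨rfl, sq_nonneg _⟩

/-- Tensoring with a fixed operator preserves bounded strong convergence. -/
theorem tendsto_tensorOp {α : Type} {l : Filter α} (M : H →L[ℂ] H) {N : α → K →L[ℂ] K}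
    {N₀ : K →L[ℂ] K} {C : ℝ} (hC : ∀ a, ‖N a‖ ≤ C)
    (hN : ∀ y, Filter.Tendsto (fun a => N a y) l (nhds (N₀ y))) (z : HilbertTensor H K) :
    Filter.Tendsto (fun a => tensorOp M (N a) z) l (nhds (tensorOp M N₀ z)) := by
  have hequi : Equicontinuous fun a => (tensorOp M (N a) : HilbertTensor H K → _) := by
    refine (LipschitzWith.uniformEquicontinuous _ (‖M‖ * C).toNNReal fun a => ?_).equicontinuous
    refine (tensorOp M (N a)).lipschitz.weaken ?_
    rw [← NNReal.coe_le_coe, coe_nnnorm]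
    refine le_trans ?_ (Real.le_coe_toNNReal _)
    refine (norm_tensorOp_le M (N a)).trans ?_
    gcongr
    exact hC a
  refine hilbertTensor_induction H K
    (hequi.isClosed_setOfPred_tendsto (tensorOp M N₀).continuous) (fun a b ha hb => ?_)
    (fun x y => ?_) z
  · simpa only [map_add] using ha.add hb
  · simp only [tensorOp_tmul]
    have hc : Continuous fun y => ((M x ⊗ₜ[ℂ] y : H ⊗[ℂ] K) : HilbertTensor H K) :=
      (UniformSpace.Completion.continuous_coe _).comp (TensorProduct.mkL ℂ H K (M x)).continuous
    exact (hc.tendsto _).comp (hN y)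

/-- The finite partial sums of `∑ⱼ |eⱼ⟩⟨eⱼ|` are contractions. -/
theorem norm_sum_rankOne_le {ι : Type} (e : HilbertBasis ι ℂ K) (s : Finset ι) :
    ‖∑ j ∈ s, InnerProductSpace.rankOne ℂ (e j) (e j)‖ ≤ 1 := by
  refine ContinuousLinearMap.opNorm_le_bound _ zero_le_one fun x => ?_
  rw [one_mul, ← sq_le_sq₀ (norm_nonneg _) (norm_nonneg _)]
  refine le_trans (le_of_eq ?_) (e.orthonormal.sum_inner_products_le x (s := s))
  simp only [sum_apply, InnerProductSpace.rankOne_apply]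
  have h := e.orthonormal.inner_sum (fun j => ⟪e j, x⟫_ℂ) (fun j => ⟪e j, x⟫_ℂ) s
  rw [inner_self_eq_norm_sq_to_K] at h
  simp only [RCLike.conj_mul] at h
  exact_mod_cast h

end TensorOp

/-! ### Partial traces -/

section PartialTrace

variable {H K : Type} [NormedAddCommGroup H] [InnerProductSpace ℂ H]
  [NormedAddCommGroup K] [InnerProductSpace ℂ K]

variable {κ : Type} {ψ : κ → HilbertTensor H K} (hψ : Summable fun k => ‖ψ k‖ ^ 2)

/-- The sesquilinear form `(u, v) ↦ τ (M ⊗ |v⟩⟨u|)` for `τ = ∑ₖ ⟨ψₖ, · ψₖ⟩`. -/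
noncomputable def partialForm (M : H →L[ℂ] H) : K →L⋆[ℂ] K →L[ℂ] ℂ :=
  LinearMap.mkContinuous₂
    (LinearMap.mk₂'ₛₗ (starRingEnd ℂ) (RingHom.id ℂ)
      (fun u v => normalFunctional hψ (tensorOp M (InnerProductSpace.rankOne ℂ v u)))
      (fun u u' v => by rw [map_add, tensorOp_add_right, map_add])
      (fun c u v => by rw [map_smulₛₗ, tensorOp_smul_right, map_smul])
      (fun u v v' => by rw [map_add, add_apply, tensorOp_add_right, map_add])
      (fun c u v => by
        rw [map_smul, smul_apply, tensorOp_smul_right, map_smul]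
        rfl))
    ((∑' k, ‖ψ k‖ ^ 2) * ‖M‖) fun u v => by
      calc ‖normalFunctional hψ (tensorOp M (InnerProductSpace.rankOne ℂ v u))‖
          ≤ (∑' k, ‖ψ k‖ ^ 2) * ‖tensorOp M (InnerProductSpace.rankOne ℂ v u)‖ :=
            norm_normalFunctional_le hψ _
        _ ≤ (∑' k, ‖ψ k‖ ^ 2) * (‖M‖ * ‖InnerProductSpace.rankOne ℂ v u‖) := by
            gcongr
            exact norm_tensorOp_le _ _
        _ = (∑' k, ‖ψ k‖ ^ 2) * ‖M‖ * ‖u‖ * ‖v‖ := by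
            rw [InnerProductSpace.norm_rankOne]
            ring

variable [CompleteSpace K]

/-- The partial trace over the first factor of `M ⊗ 1` against the functional
`τ = ∑ₖ ⟨ψₖ, · ψₖ⟩`: the operator `σ` on the second factor with `Tr (N σ) = τ (M ⊗ N)`. It is
defined by its matrix elements, that is by the case `N = |v⟩⟨u|`. -/
noncomputable def partialTrace (M : H →L[ℂ] H) : K →L[ℂ] K :=
  InnerProductSpace.continuousLinearMapOfBilin (partialForm hψ M)

theorem inner_partialTrace (M : H →L[ℂ] H) (u v : K) :
    ⟪partialTrace hψ M u, v⟫_ℂ =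
      normalFunctional hψ (tensorOp M (InnerProductSpace.rankOne ℂ v u)) :=
  InnerProductSpace.continuousLinearMapOfBilin_apply _ u v

theorem partialTrace_sum {α : Type*} (s : Finset α) (M : α → H →L[ℂ] H) :
    partialTrace hψ (∑ a ∈ s, M a) = ∑ a ∈ s, partialTrace hψ (M a) := by
  ext u
  refine ext_inner_right ℂ fun v => ?_
  rw [inner_partialTrace, tensorOp_sum_left, map_sum, sum_apply, sum_inner]
  simp only [inner_partialTrace]

variable [CompleteSpace H]

theorem partialTrace_isPositive {M : H →L[ℂ] H} (hM : M.IsPositive) :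
    (partialTrace hψ M).IsPositive := by
  refine ContinuousLinearMap.isPositive_iff_complex _ |>.mpr fun u => ?_
  rw [inner_partialTrace]
  have h := normalFunctional_nonneg hψ
    (tensorOp_isPositive hM (InnerProductSpace.isPositive_rankOne_self (𝕜 := ℂ) u))
  rw [Complex.nonneg_iff] at h
  exact ⟨Complex.ext (by simp) (by simpa using h.2), h.1⟩

/-- The defining property of the partial trace. It follows from normality, because the operators
`M ⊗ (∑_{j ∈ F} |eⱼ⟩⟨eⱼ| N)` converge strongly and boundedly to `M ⊗ N`. -/
theorem hasTrace_comp_partialTrace {M : H →L[ℂ] H} (hM : M.IsPositive) (N : K →L[ℂ] K) :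
    HasTrace (N ∘L partialTrace hψ M)
      (normalFunctional hψ (tensorOp M N)) := fun ι e => by
  let P : Finset ι → K →L[ℂ] K := fun s => ∑ j ∈ s, InnerProductSpace.rankOne ℂ (e j) (e j)
  have hbound : ∀ s, ‖P s ∘L N‖ ≤ ‖N‖ := fun s => by
    refine (ContinuousLinearMap.opNorm_comp_le _ _).trans ?_
    exact mul_le_of_le_one_left (norm_nonneg _) (norm_sum_rankOne_le e s)
  have hterm : ∀ j, ⟪e j, (N ∘L partialTrace hψ M) (e j)⟫_ℂ =
      normalFunctional hψ (tensorOp M (InnerProductSpace.rankOne ℂ (e j) (e j) ∘L N)) :=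
    fun j => by
    have hsymm : ∀ x y, ⟪partialTrace hψ M x, y⟫_ℂ =
        ⟪x, partialTrace hψ M y⟫_ℂ := fun x y =>
      (partialTrace_isPositive hψ hM).isSymmetric x y
    rw [ContinuousLinearMap.comp_apply, ← ContinuousLinearMap.adjoint_inner_left, ← hsymm,
      inner_partialTrace]
    congr 2
    ext y
    simp [ContinuousLinearMap.adjoint_inner_left]
  have hsum : ∀ s : Finset ι,
      ∑ j ∈ s, ⟪e j, (N ∘L partialTrace hψ M) (e j)⟫_ℂ =
        normalFunctional hψ (tensorOp M (P s ∘L N)) := fun s => by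
    simp only [hterm, P, ContinuousLinearMap.finsetSum_comp, tensorOp_sum_right, map_sum]
  have hP : ∀ y, Filter.Tendsto (fun s => (P s ∘L N) y) Filter.atTop (nhds (N y)) := fun y => by
    have h := e.hasSum_repr (N y)
    have h' : ∀ s, (P s ∘L N) y = ∑ j ∈ s, e.repr (N y) j • e j := fun s => by
      simp [P, e.repr_apply_apply]
    simp only [h']
    exact h
  change Filter.Tendsto _ _ _
  simp only [hsum]
  refine tendsto_normalFunctional hψ (C := ‖M‖ * ‖N‖) (fun s => ?_)
    (tendsto_tensorOp M hbound hP)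
  refine (norm_tensorOp_le _ _).trans ?_
  gcongr
  exact hbound s

end PartialTrace

/-! ### From quantum spatial correlations to quantum behaviours -/

/-- The expectation functional of a density operator is normal, given by the vectors `√ρ gₖ` for a
Hilbert basis `g`. -/
theorem IsDensityOperator.exists_normalFunctional {K : Type} [NormedAddCommGroup K]
    [InnerProductSpace ℂ K] [CompleteSpace K] {ρ : K →L[ℂ] K} (hρ : IsDensityOperator ρ) :
    ∃ (κ : Type) (ψ : κ → K) (hψ : Summable fun k => ‖ψ k‖ ^ 2),
      ∀ X t, HasTrace (X ∘L ρ) t → normalFunctional hψ X = t := by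
  obtain ⟨κ, g, -⟩ := exists_hilbertBasis_type K
  obtain ⟨R, hR, hRR⟩ := exists_isPositive_sqrt hρ.positive
  exact ⟨κ, fun k => R (g k), (hasSum_norm_sqrt_sq hR hRR hρ.trace_one g).summable,
    fun X t ht => (hρ.trace_one.comp_left hR hRR X g).unique ht⟩

theorem tensorOp_id_id {H K : Type} [NormedAddCommGroup H] [InnerProductSpace ℂ H]
    [NormedAddCommGroup K] [InnerProductSpace ℂ K] :
    tensorOp (ContinuousLinearMap.id ℂ H) (ContinuousLinearMap.id ℂ K) =
      ContinuousLinearMap.id ℂ (HilbertTensor H K) :=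
  hilbertTensor_ext fun x y => by rw [tensorOp_tmul]; rfl

theorem isPositive_ofReal_smul {H : Type} [NormedAddCommGroup H] [InnerProductSpace ℂ H]
    {T : H →L[ℂ] H} (hT : T.IsPositive) {c : ℝ} (hc : 0 ≤ c) : ((c : ℂ) • T).IsPositive := by
  refine ContinuousLinearMap.IsPositive.smul_of_nonneg hT ?_
  rw [Complex.nonneg_iff]
  exact ⟨by simpa using hc, by simp⟩

namespace BellScenario

variable {S : BellScenario}

/-- The value of the mixture `∑ₐ r(a|x) P_{a|x}` in a complex vector space. -/
theorem sum_mixture_complex_smul {E : Type*} [AddCommGroup E] [Module ℂ E] (r : S.MargVec)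
    (x : Fin S.X) (F : Prep r → E) [∀ a, Decidable (0 < r x a)] :
    ∑ s, (mixture r x s : ℂ) • F s =
      ∑ a, if h : 0 < r x a then (r x a : ℂ) • F ⟨⟨x, a⟩, h⟩ else 0 := by
  let _ : Module ℝ E := Module.compHom E Complex.ofRealHom
  exact sum_mixture_smul r x F

/-! Marginals of a correlation `p(a,b|x,y) = τ (M ⊗ N)` given by a normal functional `τ`. -/

section NormalModel

variable {HA HB : Type} [NormedAddCommGroup HA] [InnerProductSpace ℂ HA]
  [NormedAddCommGroup HB] [InnerProductSpace ℂ HB]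
  {κ : Type} {ψ : κ → HilbertTensor HA HB} {hψ : Summable fun k => ‖ψ k‖ ^ 2}
  {M : (x : Fin S.X) → Fin (S.A x) → HA →L[ℂ] HA} {N : (y : Fin S.Y) → Fin (S.B y) → HB →L[ℂ] HB}
  {p : S.CorrVec}

theorem sum_right_of_normalModel (hN : ∀ y, IsPOVM (N y))
    (hp : ∀ x y a b, normalFunctional hψ (tensorOp (M x a) (N y b)) = p x y a b)
    (x : Fin S.X) (y : Fin S.Y) (a : Fin (S.A x)) :
    ((∑ b, p x y a b : ℝ) : ℂ) =
      normalFunctional hψ (tensorOp (M x a) (ContinuousLinearMap.id ℂ HB)) := by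
  rw [← (hN y).sum_eq_one, tensorOp_sum_right, map_sum, Complex.ofReal_sum]
  simp only [hp]

theorem sum_left_of_normalModel (hM : ∀ x, IsPOVM (M x))
    (hp : ∀ x y a b, normalFunctional hψ (tensorOp (M x a) (N y b)) = p x y a b)
    (x : Fin S.X) (y : Fin S.Y) (b : Fin (S.B y)) :
    ((∑ a, p x y a b : ℝ) : ℂ) =
      normalFunctional hψ (tensorOp (ContinuousLinearMap.id ℂ HA) (N y b)) := by
  rw [← (hM x).sum_eq_one, tensorOp_sum_left, map_sum, Complex.ofReal_sum]
  simp only [hp]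

end NormalModel

theorem quantumSpatial_subset_nonSignalling : S.quantumSpatial ⊆ S.nonSignalling := by
  rintro p ⟨HA, _, _, _, _, HB, _, _, _, _, M, N, ρ, hM, hN, hρ, hp⟩
  obtain ⟨κ, ψ, hψ, hτ⟩ := hρ.exists_normalFunctional
  have hp' : ∀ x y a b, normalFunctional hψ (tensorOp (M x a) (N y b)) = p x y a b :=
    fun x y a b => hτ _ _ (hp x y a b)
  refine ⟨⟨fun x y a b => ?_, fun x y => ?_⟩, fun x a y y' => ?_, fun y b x x' => ?_⟩
  · have h := normalFunctional_nonneg hψ (tensorOp_isPositive ((hM x).positive a)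
      ((hN y).positive b))
    rw [hp', Complex.nonneg_iff] at h
    simpa using h.1
  · have h : ((∑ a, ∑ b, p x y a b : ℝ) : ℂ) = 1 := by
      rw [Complex.ofReal_sum]
      simp only [sum_right_of_normalModel hN hp' x y]
      rw [← map_sum, ← tensorOp_sum_left, (hM x).sum_eq_one, tensorOp_id_id]
      exact hτ _ _ hρ.trace_one
    exact_mod_cast h
  · exact_mod_cast (sum_right_of_normalModel hN hp' x y a).trans
      (sum_right_of_normalModel hN hp' x y' a).symm
  · exact_mod_cast (sum_left_of_normalModel hM hp' x y b).trans
      (sum_left_of_normalModel hM hp' x' y b).symm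

/-- Alice's measurement prepares for Bob the normalised partial traces of `(M ⊗ 1) ρ`; their
mixture is Bob's reduced state, whatever Alice measures. -/
theorem mapsTo_toContextuality_quantumSpatial :
    Set.MapsTo S.toContextuality S.quantumSpatial S.quantumFamily := by
  classical
  intro p hqs
  have hns := quantumSpatial_subset_nonSignalling hqs
  obtain ⟨HA, _, _, _, _, HB, nB, iB, cB, sB, M, N, ρ, hM, hN, hρ, hp⟩ := hqs
  obtain ⟨κ, ψ, hψ, hτ⟩ := hρ.exists_normalFunctional
  have hp' : ∀ x y a b, normalFunctional hψ (tensorOp (M x a) (N y b)) = p x y a b :=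
    fun x y a b => hτ _ _ (hp x y a b)
  let σ : (x : Fin S.X) → Fin (S.A x) → HB →L[ℂ] HB := fun x a => partialTrace hψ (M x a)
  have hσ : ∀ x a, (σ x a).IsPositive := fun x a =>
    partialTrace_isPositive hψ ((hM x).positive a)
  have htr : ∀ x a, HasTrace (σ x a) (marginal p x a) := fun x a => by
    have h := hasTrace_comp_partialTrace hψ ((hM x).positive a) (ContinuousLinearMap.id ℂ HB)
    rw [← sum_right_of_normalModel hN hp' x ⟨0, S.Y_pos⟩ a] at h
    exact h
  let ρ' : Prep (marginal p) → HB →L[ℂ] HB :=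
    fun s => (((marginal p s.1.1 s.1.2)⁻¹ : ℝ) : ℂ) • σ s.1.1 s.1.2
  have hρ' : ∀ s, IsDensityOperator (ρ' s) := fun s => by
    refine ⟨isPositive_ofReal_smul (hσ _ _) (inv_nonneg.mpr s.2.le), ?_⟩
    have h := (htr s.1.1 s.1.2).smul (((marginal p s.1.1 s.1.2)⁻¹ : ℝ) : ℂ)
    rw [← Complex.ofReal_mul, inv_mul_cancel₀ s.2.ne', Complex.ofReal_one] at h
    exact h
  have hmix : ∀ x, ∑ s, (mixture (marginal p) x s : ℂ) • ρ' s =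
      partialTrace hψ (ContinuousLinearMap.id ℂ HA) := fun x => by
    rw [sum_mixture_complex_smul, ← (hM x).sum_eq_one, partialTrace_sum]
    refine Finset.sum_congr rfl fun a _ => ?_
    split_ifs with h
    · have h0 : (marginal p x a : ℂ) ≠ 0 := by exact_mod_cast h.ne'
      simp only [ρ', σ, smul_smul, Complex.ofReal_inv, mul_inv_cancel₀ h0, one_smul]
    · -- Here `σ x a` has trace `p_A(a|x) = 0`.
      have h0 : marginal p x a = 0 :=
        le_antisymm (not_lt.mp h) ((marginal_isMarginal hns.1 x).1 a)
      have h1 := htr x a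
      rw [h0, Complex.ofReal_zero] at h1
      exact (eq_zero_of_hasTrace_zero (hσ x a) h1).symm
  refine ⟨marginal_isMarginal hns.1, HB, nB, iB, cB, sB, N, ρ', hN, hρ', ?_, fun s y b => ?_⟩
  · rintro _ ⟨x, x', rfl⟩
    exact (hmix x).trans (hmix x').symm
  · have h := (hasTrace_comp_partialTrace hψ ((hM s.1.1).positive s.1.2) (N y b)).smul
      (((marginal p s.1.1 s.1.2)⁻¹ : ℝ) : ℂ)
    rw [hp', ← ContinuousLinearMap.comp_smul, ← Complex.ofReal_mul, inv_mul_eq_div] at h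
    exact h

end BellScenario

/-! ### From quantum behaviours to quantum spatial correlations -/

section Steering

variable (H : Type) [NormedAddCommGroup H] [InnerProductSpace ℂ H] [CompleteSpace H]

/-- Every Hilbert space carries an antiunitary involution: complex conjugation of the coordinates
in a Hilbert basis. -/
theorem exists_conjugation : ∃ C : H →ₗ⋆[ℂ] H,
    (∀ x y, ⟪C x, C y⟫_ℂ = ⟪y, x⟫_ℂ) ∧ ∀ x, C (C x) = x := by
  obtain ⟨ι, e, -⟩ := exists_hilbertBasis_type H
  refine ⟨⟨⟨fun x => e.repr.symm (star (e.repr x)), fun x y => by simp⟩, fun c x => by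
    simp [star_smul]⟩, fun x y => ?_, fun x => ?_⟩
  · change ⟪e.repr.symm (star (e.repr x)), e.repr.symm (star (e.repr y))⟫_ℂ = _
    rw [LinearIsometryEquiv.inner_map_map, ← e.repr.inner_map_map, lp.inner_eq_tsum,
      lp.inner_eq_tsum]
    refine tsum_congr fun i => ?_
    simp [mul_comm]
  · change e.repr.symm (star (e.repr (e.repr.symm (star (e.repr x))))) = x
    simp

variable {H}

theorem norm_le_of_inner_le {E F : Type} [NormedAddCommGroup E] [InnerProductSpace ℂ E]
    [NormedAddCommGroup F] [InnerProductSpace ℂ F] {x : E} {y : F}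
    (h : (⟪x, x⟫_ℂ).re ≤ (⟪y, y⟫_ℂ).re) : ‖x‖ ≤ ‖y‖ := by
  have h1 : ‖x‖ ^ 2 ≤ ‖y‖ ^ 2 := by
    rw [← inner_self_eq_norm_sq (𝕜 := ℂ), ← inner_self_eq_norm_sq (𝕜 := ℂ)]
    exact h
  exact (sq_le_sq₀ (norm_nonneg _) (norm_nonneg _)).mp h1

/-- A positive operator `σ` factors antilinearly through a Hilbert space in which every
decomposition of `σ` into positive operators becomes a POVM. The space is the closure of the range
of the complex conjugate `C √σ C`, and `w = C √σ`; if `D` is the contraction with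
`D C √σ = C √T`, then `T` becomes `D* D`. -/
theorem exists_povm_of_decomposition [TopologicalSpace.SeparableSpace H] {σ : H →L[ℂ] H}
    (hσ : σ.IsPositive) :
    ∃ (G : Type) (_ : NormedAddCommGroup G) (_ : InnerProductSpace ℂ G) (_ : CompleteSpace G)
      (_ : TopologicalSpace.SeparableSpace G) (w : H → G),
      (∀ u v, ⟪w u, w v⟫_ℂ = ⟪v, σ u⟫_ℂ) ∧
      ∀ (n : ℕ) (T : Fin n → H →L[ℂ] H), (∀ a, (T a).IsPositive) → ∑ a, T a = σ →
        ∃ M : Fin n → G →L[ℂ] G, IsPOVM M ∧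
          ∀ a u v, ⟪w u, M a (w v)⟫_ℂ = ⟪v, T a u⟫_ℂ := by
  obtain ⟨C, hC, hCC⟩ := exists_conjugation H
  obtain ⟨R, hR, hRR⟩ := exists_isPositive_sqrt hσ
  let bar : (H →L[ℂ] H) → H →ₗ[ℂ] H := fun A => C.comp (A.toLinearMap.comp C)
  have hbar : ∀ A x, bar A x = C (A (C x)) := fun A x => rfl
  let G : Submodule ℂ H := (LinearMap.range (bar R)).topologicalClosure
  have hmem : ∀ x, bar R x ∈ G := fun x =>
    Submodule.le_topologicalClosure _ (LinearMap.mem_range_self _ x)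
  let e : H →ₗ[ℂ] G := (bar R).codRestrict G hmem
  have he : ∀ u v, ⟪e u, e v⟫_ℂ = ⟪R (C v), R (C u)⟫_ℂ := fun u v => hC _ _
  -- Density is only in `G`, not in `H`: this is why `∑ D* D = 1` needs no correction on `ker σ`.
  have hdense : DenseRange e := by
    intro z
    rw [closure_subtype, ← Set.range_comp]
    have hz := z.2
    rw [← SetLike.mem_coe, Submodule.topologicalClosure_coe, LinearMap.coe_range] at hz
    exact hz
  have hcomplete : CompleteSpace G :=
    (Submodule.isClosed_topologicalClosure _).completeSpace_coe
  have hsep : TopologicalSpace.SeparableSpace G := by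
    have := UniformSpace.secondCountable_of_separable H
    infer_instance
  have hw : ∀ u v, ⟪e (C u), e (C v)⟫_ℂ = ⟪v, σ u⟫_ℂ := fun u v => by
    rw [he, hCC, hCC, inner_sqrt_sqrt hR hRR]
  refine ⟨G, inferInstance, inferInstance, hcomplete, hsep, fun v => e (C v), hw,
    fun n T hT hsum => ?_⟩
  choose Q hQ hQQ using fun a => exists_isPositive_sqrt (hT a)
  have hle : ∀ a x, ‖bar (Q a) x‖ ≤ 1 * ‖e x‖ := fun a x => by
    rw [one_mul]
    refine norm_le_of_inner_le ?_
    rw [he, hbar, hC, inner_sqrt_sqrt (hQ a) (hQQ a), inner_sqrt_sqrt hR hRR, ← hsum,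
      sum_apply, inner_sum, Complex.re_sum]
    exact Finset.single_le_sum (f := fun a => (⟪C x, T a (C x)⟫_ℂ).re)
      (fun a _ => (Complex.nonneg_iff.mp ((hT a).inner_nonneg_right _)).1) (Finset.mem_univ a)
  let D : Fin n → G →L[ℂ] H := fun a => (bar (Q a)).extendOfNorm e
  have hD : ∀ a x, D a (e x) = bar (Q a) x := fun a x =>
    LinearMap.extendOfNorm_eq hdense ⟨1, hle a⟩ x
  have hM : ∀ a u v, ⟪e (C u), ((D a).adjoint ∘L D a) (e (C v))⟫_ℂ = ⟪v, T a u⟫_ℂ :=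
    fun a u v => by
    rw [ContinuousLinearMap.comp_apply, ContinuousLinearMap.adjoint_inner_right, hD, hD, hbar,
      hbar, hC, hCC, hCC, inner_sqrt_sqrt (hQ a) (hQQ a)]
  refine ⟨fun a => (D a).adjoint ∘L D a,
    ⟨fun a => ContinuousLinearMap.isPositive_adjoint_comp_self _, ?_⟩, hM⟩
  have h : ∀ z y, ⟪z, (∑ a, (D a).adjoint ∘L D a) y⟫_ℂ = ⟪z, y⟫_ℂ := fun z y =>
    hdense.induction_on₂
      (p := fun z y => ⟪z, (∑ a, (D a).adjoint ∘L D a) y⟫_ℂ = ⟪z, y⟫_ℂ)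
      (isClosed_eq
        (continuous_fst.inner ((∑ a, (D a).adjoint ∘L D a).continuous.comp continuous_snd))
        (continuous_fst.inner continuous_snd))
      (fun u v => by
        rw [← hCC u, ← hCC v, hw, sum_apply, inner_sum]
        simp only [hM]
        rw [← inner_sum, ← sum_apply, hsum]) z y
  ext1 y
  exact ext_inner_left ℂ fun z => h z y

omit [CompleteSpace H] in
/-- The vector `∑ᵢ w(eᵢ) ⊗ eᵢ` exists when `∑ᵢ ‖w(eᵢ)‖²` converges. -/
theorem summable_tmul_hilbertBasis {G : Type} [NormedAddCommGroup G] [InnerProductSpace ℂ G]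
    {ι : Type} (e : HilbertBasis ι ℂ H) {w : ι → G} (hw : Summable fun i => ‖w i‖ ^ 2) :
    Summable fun i => ((w i ⊗ₜ[ℂ] e i : G ⊗[ℂ] H) : HilbertTensor G H) := by
  let V : ι → G →ₗᵢ[ℂ] HilbertTensor G H := fun i =>
    { toFun := fun x => ((x ⊗ₜ[ℂ] e i : G ⊗[ℂ] H) : HilbertTensor G H)
      map_add' := fun x y => by
        rw [TensorProduct.add_tmul, UniformSpace.Completion.coe_add]
      map_smul' := fun c x => by
        rw [← TensorProduct.smul_tmul', UniformSpace.Completion.coe_smul]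
        rfl
      norm_map' := fun x => by
        change ‖((x ⊗ₜ[ℂ] e i : G ⊗[ℂ] H) : HilbertTensor G H)‖ = ‖x‖
        rw [norm_tmul_coe, e.orthonormal.1 i, mul_one] }
  have hV : OrthogonalFamily ℂ (fun _ => G) V := fun i j hij x y => by
    change ⟪((x ⊗ₜ[ℂ] e i : G ⊗[ℂ] H) : HilbertTensor G H), ((y ⊗ₜ[ℂ] e j : G ⊗[ℂ] H))⟫_ℂ = 0
    rw [inner_tmul_coe, e.orthonormal.2 hij, mul_zero]
  exact (hV.summable_iff_norm_sq_summable w).mpr hw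

/-- The expectation of `M ⊗ N` in the vector `∑ᵢ w(eᵢ) ⊗ eᵢ` is the trace of `N T`, when the
matrix of `M` with respect to the `w(eᵢ)` is the transpose of that of `T`. -/
theorem inner_tensorOp_purification {G : Type} [NormedAddCommGroup G] [InnerProductSpace ℂ G]
    {ι : Type} (e : HilbertBasis ι ℂ H) {w : H → G} {ψ : HilbertTensor G H}
    (hψ : HasSum (fun i => ((w (e i) ⊗ₜ[ℂ] e i : G ⊗[ℂ] H) : HilbertTensor G H)) ψ)
    {M : G →L[ℂ] G} {T : H →L[ℂ] H} (hMT : ∀ u v, ⟪w u, M (w v)⟫_ℂ = ⟪v, T u⟫_ℂ)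
    {N : H →L[ℂ] H} {t : ℂ} (ht : HasTrace (N ∘L T) t) : ⟪ψ, tensorOp M N ψ⟫_ℂ = t := by
  have h1 : HasSum (fun i => ⟪((w (e i) ⊗ₜ[ℂ] e i : G ⊗[ℂ] H) : HilbertTensor G H),
      tensorOp M N ψ⟫_ℂ) ⟪ψ, tensorOp M N ψ⟫_ℂ :=
    hψ.mapL (innerSLFlip ℂ (tensorOp M N ψ))
  refine h1.unique ((ht ι e).congr_fun fun i => ?_)
  have h2 : HasSum (fun j => ⟪((w (e i) ⊗ₜ[ℂ] e i : G ⊗[ℂ] H) : HilbertTensor G H),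
      tensorOp M N ((w (e j) ⊗ₜ[ℂ] e j : G ⊗[ℂ] H))⟫_ℂ)
      ⟪((w (e i) ⊗ₜ[ℂ] e i : G ⊗[ℂ] H) : HilbertTensor G H), tensorOp M N ψ⟫_ℂ :=
    (hψ.mapL (tensorOp M N)).mapL
      (innerSL ℂ ((w (e i) ⊗ₜ[ℂ] e i : G ⊗[ℂ] H) : HilbertTensor G H))
  have h3 := e.hasSum_inner_mul_inner (N.adjoint (e i)) (T (e i))
  rw [ContinuousLinearMap.adjoint_inner_left] at h3
  refine h2.unique (h3.congr_fun fun j => ?_)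
  rw [tensorOp_tmul, inner_tmul_coe, hMT, ContinuousLinearMap.adjoint_inner_left, mul_comm]

/-- **Steering**: a density operator `σ` has a purification with the property that every
decomposition of `σ` into positive operators is prepared by a POVM on the purifying system. -/
theorem exists_steering [TopologicalSpace.SeparableSpace H] {σ : H →L[ℂ] H}
    (hσ : IsDensityOperator σ) :
    ∃ (G : Type) (_ : NormedAddCommGroup G) (_ : InnerProductSpace ℂ G) (_ : CompleteSpace G)
      (_ : TopologicalSpace.SeparableSpace G) (ρ : HilbertTensor G H →L[ℂ] HilbertTensor G H),
      IsDensityOperator ρ ∧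
      ∀ (n : ℕ) (T : Fin n → H →L[ℂ] H), (∀ a, (T a).IsPositive) → ∑ a, T a = σ →
        ∃ M : Fin n → G →L[ℂ] G, IsPOVM M ∧
          ∀ a N t, HasTrace (N ∘L T a) t → HasTrace (tensorOp (M a) N ∘L ρ) t := by
  obtain ⟨G, _, _, hG, hG', w, hw, hpovm⟩ := exists_povm_of_decomposition hσ.positive
  obtain ⟨ι, e, -⟩ := exists_hilbertBasis_type H
  have hsq : Summable fun i => ‖w (e i)‖ ^ 2 := by
    refine ((hσ.trace_one ι e).mapL Complex.reCLM).summable.congr fun i => ?_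
    rw [← inner_self_eq_norm_sq (𝕜 := ℂ), hw]
    rfl
  obtain ⟨ψ, hψ⟩ := summable_tmul_hilbertBasis e hsq
  refine ⟨G, _, _, hG, hG', InnerProductSpace.rankOne ℂ ψ ψ,
    ⟨InnerProductSpace.isPositive_rankOne_self ψ, ?_⟩, fun n T hT hsum => ?_⟩
  · have h := hasTrace_comp_rankOne
      (tensorOp (ContinuousLinearMap.id ℂ G) (ContinuousLinearMap.id ℂ H)) ψ
    rw [inner_tensorOp_purification e hψ (M := ContinuousLinearMap.id ℂ G) hw
      (N := ContinuousLinearMap.id ℂ H) hσ.trace_one, tensorOp_id_id] at h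
    exact h
  · obtain ⟨M, hM, hMT⟩ := hpovm n T hT hsum
    refine ⟨M, hM, fun a N t ht => ?_⟩
    rw [← inner_tensorOp_purification e hψ (hMT a) ht]
    exact hasTrace_comp_rankOne _ ψ

end Steering

namespace BellScenario

variable {S : BellScenario}

theorem quantumFamily_normalised {t : S.IndexedVec} (ht : t ∈ S.quantumFamily) :
    IsMarginal t.1 ∧ ∀ s y, ∑ b, t.2 s y b = 1 := by
  obtain ⟨hr, H, _, _, _, _, N, ρ, hN, hρ, -, hq⟩ := ht
  refine ⟨hr, fun s y => ?_⟩
  have h : HasTrace (∑ b, N y b ∘L ρ s) (∑ b, (t.2 s y b : ℂ)) :=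
    HasTrace.sum _ fun b _ => hq s y b
  rw [← ContinuousLinearMap.finsetSum_comp, (hN y).sum_eq_one] at h
  exact_mod_cast h.unique (hρ s).trace_one

/-- The operators `r(a|x) ρ_{a|x}` decompose one and the same density operator for every `x`, so
Alice can prepare them by measuring a purification of it. -/
theorem mapsTo_toBell_quantumFamily :
    Set.MapsTo S.toBell S.quantumFamily S.quantumSpatial := by
  classical
  rintro ⟨r, q⟩ ⟨hr, H, nH, iH, cH, sH, N, ρ, hN, hρ, heq, hq⟩
  change IsMarginal r at hr
  change Prep r → H →L[ℂ] H at ρ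
  change ∀ s y b, HasTrace (N y b ∘L ρ s) (q s y b : ℂ) at hq
  let T : (x : Fin S.X) → Fin (S.A x) → H →L[ℂ] H := fun x a =>
    if h : 0 < r x a then (r x a : ℂ) • ρ ⟨⟨x, a⟩, h⟩ else 0
  have hT : ∀ x a, (T x a).IsPositive := fun x a => by
    simp only [T]
    split_ifs with h
    · exact isPositive_ofReal_smul (hρ _).positive h.le
    · exact ContinuousLinearMap.isPositive_zero
  have htr : ∀ x a, HasTrace (T x a) (r x a) := fun x a => by
    simp only [T]
    split_ifs with h
    · simpa using (hρ ⟨⟨x, a⟩, h⟩).trace_one.smul (r x a : ℂ)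
    · rw [le_antisymm (not_lt.mp h) ((hr x).1 a), Complex.ofReal_zero]
      exact HasTrace.zero
  let x₀ : Fin S.X := ⟨0, S.X_pos⟩
  have hsum : ∀ x, ∑ a, T x a = ∑ a, T x₀ a := fun x => by
    refine (sum_mixture_complex_smul r x ρ).symm.trans ?_
    exact (heq _ ⟨x, x₀, rfl⟩).trans (sum_mixture_complex_smul r x₀ ρ)
  have hσ : IsDensityOperator (∑ a, T x₀ a) := by
    refine ⟨ContinuousLinearMap.isPositive_sum _ fun a _ => hT x₀ a, ?_⟩
    have h := HasTrace.sum Finset.univ fun a _ => htr x₀ a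
    have h1 : ∑ a, (r x₀ a : ℂ) = 1 := by exact_mod_cast (hr x₀).2
    rwa [h1] at h
  obtain ⟨G, nG, iG, cG, sG, ω, hω, hpovm⟩ := exists_steering hσ
  choose M hM hMT using fun x => hpovm _ (T x) (hT x) (hsum x)
  refine ⟨G, nG, iG, cG, sG, H, nH, iH, cH, sH, M, N, ω, hM, hN, hω, fun x y a b => ?_⟩
  refine hMT x a (N y b) _ ?_
  simp only [T, toBell]
  split_ifs with h
  · have h1 := (hq ⟨⟨x, a⟩, h⟩ y b).smul (r x a : ℂ)
    rw [← ContinuousLinearMap.comp_smul] at h1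
    simpa using h1
  · simpa using HasTrace.zero

end BellScenario

end BellContextuality

open BellContextuality BellScenario in
theorem mainTheorem1 (S : BellContextuality.BellScenario) :
    (Set.BijOn S.toContextuality S.nonSignalling S.contextualFamily ∧
      Set.InvOn S.toBell S.toContextuality S.nonSignalling S.contextualFamily) ∧
    (Set.BijOn S.toContextuality S.localSet S.nonContextualFamily ∧
      Set.InvOn S.toBell S.toContextuality S.localSet S.nonContextualFamily) ∧
    (Set.BijOn S.toContextuality S.quantumSpatial S.quantumFamily ∧
      Set.InvOn S.toBell S.toContextuality S.quantumSpatial S.quantumFamily) :=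
  ⟨bijOn_and_invOn subset_rfl (fun _ ht => ⟨ht.1, ht.2.2.1⟩)
      mapsTo_toContextuality_nonSignalling mapsTo_toBell_contextualFamily,
    bijOn_and_invOn localSet_subset_nonSignalling (fun _ => nonContextualFamily_normalised)
      mapsTo_toContextuality_localSet mapsTo_toBell_nonContextualFamily,
    bijOn_and_invOn quantumSpatial_subset_nonSignalling (fun _ => quantumFamily_normalised)
      mapsTo_toContextuality_quantumSpatial mapsTo_toBell_quantumFamily⟩
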